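/- Work over $\mathbb{C}$. A point-line problem in $m$ views consists of numbers $p,l$ of points and lines, an incidence relation $\mathcal{I}\subset\{1,\dots,p\}\times\{1,\dots,l\}$, and, for each view $v=1,\dots,m$, sets $\mathcal{P}_v\subset\{1,\dots,p\}$ and $\mathcal{L}_v\subset\{1,\dots,l\}$ of observed points and lines. It is assumed that $\mathcal{I}$ is realizable by pairwise distinct points and pairwise distinct lines in $\mathbb{R}^3$ and contains every incidence that it implies for such arrangements, and that a view which observes two distinct lines incident (according to $\mathcal{I}$) to a common point also observes this point. The problem is a PL1P if each line is incident to at most one point. Let $\mathcal{X}$ be the variety of $(X,L)\in(\mathbb{P}^3)^p\times(\mathbb{G}_{1,3})^l$ with $X_i\in L_j$ for all $(i,j)\in\mathcal{I}$, let $\mathcal{C}_m$ be the variety of $m$-tuples of cameras $[R_v\mid t_v]$ with $R_v\in\mathrm{SO}(3,\mathbb{C})$, $t_v\in\mathbb{C}^3$, $R_1=I$, $t_1=0$ and first coordinate of $t_2$ equal to $1$, and let $\mathcal{Y}$ be the variety of tuples of points $x_{v,i}\in\mathbb{P}^2$ $(i\in\mathcal{P}_v)$ and lines $\ell_{v,j}\subset\mathbb{P}^2$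 $(j\in\mathcal{L}_v)$ with $x_{v,i}\in\ell_{v,j}$ whenever $(i,j)\in\mathcal{I}$. The joint camera map $\Phi:\mathcal{X}\times\mathcal{C}_m\dashrightarrow\mathcal{Y}$ projects each point and line to the views that observe it; it is defined where no observed point is, and no observed line contains, the centre of an observing camera. "Generic" means: on a Zariski-dense open subset. The problem is minimal if for generic $y\in\mathcal{Y}$ the fibre $\Phi^{-1}(y)$ is nonempty and finite; its degree is then the cardinality of $\Phi^{-1}(y)$ for generic $y\in\mathcal{Y}$. A PL1P $(p,l,\mathcal{I},\mathcal{O})$ is reducible to a PL1P $(p',l',\mathcal{I}',\mathcal{O}')$ with the same number of views if the latter is obtained from it, up to relabeling of points and lines, by forgetting some points and lines (keeping the incidences and observations among the remaining ones), so that, with $\Pi:\mathcal{X}\times\mathcal{C}_m\to\mathcal{X}'\times\mathcal{C}_m$ and $\pi:\mathcal{Y}\to\mathcal{Y}'$ the induced projections and $\Phi'$ the joint camera map of the latter problem: (i) for each forgotten point, at most one of the lines incident to it is kept; and (ii) for generic $S'\in\mathcal{X}'\times\mathcal{C}_m$ and generic $y\in\pi^{-1}(\Phi'(S'))$ there is $S\in\mathcal{X}\times\mathcal{C}_m$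 with $\Phi(S)=y$ and $\Pi(S)=S'$. Theorem. If a PL1P is minimal and reducible to another PL1P, then both are minimal and have the same degree: there is a natural number $d$ such that, for each of the two problems, a generic joint image has exactly $d$ complex solutions. -/

import Mathlib

open scoped LinearAlgebra.Projectivization

noncomputable section

/-! ### Zariski topology and genericity -/

/-- The Zariski topology on the affine space `ℂ^σ`: the sets `{x | f x ≠ 0}`, for polynomials `f`,
form a basis of open sets. -/
@[reducible] def zariskiAffine (σ : Type) : TopologicalSpace (σ → ℂ) :=
  TopologicalSpace.generateFrom
    (Set.range fun f : MvPolynomial σ ℂ => {x : σ → ℂ | MvPolynomial.eval x f ≠ 0})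

/-- The quotient Zariski topology on a set `T` whose elements are described by coordinates in a
subset `A` of an affine space, through a surjection `q : A → T`. -/
@[reducible] def zariskiQuotient {σ T : Type} (A : Set (σ → ℂ)) (q : A → T) : TopologicalSpace T :=
  TopologicalSpace.coinduced q (TopologicalSpace.induced Subtype.val (zariskiAffine σ))

/-- `Q` holds for a generic element of `V`: it holds on a relatively open dense subset of `V`. -/
def Generically {T : Type} [TopologicalSpace T] (V : Set T) (Q : T → Prop) : Prop :=
  ∃ U : Set T, IsOpen U ∧ V ⊆ closure (V ∩ U) ∧ ∀ x ∈ V ∩ U, Q x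

/-! ### Points and lines in complex projective space -/

/-- Points of `ℙ^(n-1)` over `ℂ`. -/
abbrev ProjPoint (n : ℕ) : Type := ℙ ℂ (Fin n → ℂ)

/-- Lines in `ℙ^(n-1)` over `ℂ`, i.e. two-dimensional linear subspaces of `ℂ^n`. -/
abbrev ProjLine (n : ℕ) : Type :=
  {W : Submodule ℂ (Fin n → ℂ) // Module.finrank ℂ W = 2}

/-- The line spanned by two linearly independent vectors. -/
def ProjLine.span {n : ℕ} (b : Fin 2 → Fin n → ℂ) (h : LinearIndependent ℂ b) : ProjLine n :=
  ⟨Submodule.span ℂ (Set.range b), by simpa using finrank_span_eq_card h⟩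

/-! ### Point-line problems -/

/-- `X`, `L` are pairwise distinct points and pairwise distinct lines in `ℝ³` satisfying (at least)
the incidences in `I`. -/
def RealizesIncidences {p l : ℕ} (I : Fin p → Fin l → Prop)
    (X : Fin p → EuclideanSpace ℝ (Fin 3))
    (L : Fin l → AffineSubspace ℝ (EuclideanSpace ℝ (Fin 3))) : Prop :=
  Function.Injective X ∧ Function.Injective L ∧
    (∀ j, (L j : Set (EuclideanSpace ℝ (Fin 3))).Nonempty ∧
      Module.finrank ℝ (L j).direction = 1) ∧
    ∀ i j, I i j → X i ∈ L j

/-- A point-line problem in `m` views. -/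
structure PointLineProblem (m : ℕ) where
  /-- number of points -/
  p : ℕ
  /-- number of lines -/
  l : ℕ
  /-- `inc i j`: the `i`-th point is on the `j`-th line -/
  inc : Fin p → Fin l → Prop
  /-- points observed in each view -/
  obsPt : Fin m → Set (Fin p)
  /-- lines observed in each view -/
  obsLine : Fin m → Set (Fin l)
  realizable : ∃ X L, RealizesIncidences inc X L
  complete : ∀ i j, (∀ X L, RealizesIncidences inc X L → X i ∈ L j) → inc i j
  obs_meet : ∀ v, ∀ j ∈ obsLine v, ∀ j' ∈ obsLine v, j ≠ j' →
    ∀ i, inc i j → inc i j' → i ∈ obsPt v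

/-- Each line is incident to at most one point. -/
def PointLineProblem.IsPL1P {m : ℕ} (P : PointLineProblem m) : Prop :=
  ∀ j i i', P.inc i j → P.inc i' j → i = i'

/-! ### Arrangements with cameras -/

/-- `p` points and `l` lines in `ℙ³` together with `m` complex `3 × 4` matrices. -/
structure World (p l m : ℕ) where
  pt : Fin p → ProjPoint 4
  line : Fin l → ProjLine 4
  cam : Fin m → Matrix (Fin 3) (Fin 4) ℂ

/-- Coordinates on `World p l m`: homogeneous coordinates of the points, two spanning vectors for
each line, and the entries of the matrices. -/
abbrev WorldIndex (p l m : ℕ) : Type :=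
  (Fin p × Fin 4) ⊕ (Fin l × Fin 2 × Fin 4) ⊕ (Fin m × Fin 3 × Fin 4)

/-- Coordinate vectors that describe an element of `World p l m`. -/
def worldCoords (p l m : ℕ) : Set (WorldIndex p l m → ℂ) :=
  {b | (∀ i, (fun c => b (.inl (i, c))) ≠ 0) ∧
    ∀ j, LinearIndependent ℂ fun (r : Fin 2) (c : Fin 4) => b (.inr (.inl (j, r, c)))}

/-- The element of `World p l m` with the given coordinates. -/
def worldOfCoords (p l m : ℕ) (b : worldCoords p l m) : World p l m where
  pt i := Projectivization.mk ℂ (fun c => b.1 (.inl (i, c))) (b.2.1 i)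
  line j := ProjLine.span (fun r c => b.1 (.inr (.inl (j, r, c)))) (b.2.2 j)
  cam v := Matrix.of fun a c => b.1 (.inr (.inr (v, a, c)))

instance (p l m : ℕ) : TopologicalSpace (World p l m) :=
  zariskiQuotient (worldCoords p l m) (worldOfCoords p l m)

/-- Left `3 × 3` block of a `3 × 4` matrix `[R | t]`. -/
def camRot (A : Matrix (Fin 3) (Fin 4) ℂ) : Matrix (Fin 3) (Fin 3) ℂ :=
  A.submatrix id Fin.castSucc

/-- Last column of a `3 × 4` matrix `[R | t]`. -/
def camTrans (A : Matrix (Fin 3) (Fin 4) ℂ) : Fin 3 → ℂ := fun a => A a (Fin.last 3)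

/-- The (complexified) variety of configurations of `m` calibrated cameras `[R_v | t_v]`, with
`R_v ∈ SO(3)`, normalized by `R_1 = I`, `t_1 = 0` and first coordinate of `t_2` equal to `1`. -/
def cameraVariety (m : ℕ) : Set (Fin m → Matrix (Fin 3) (Fin 4) ℂ) :=
  {A | (∀ v, (camRot (A v)).transpose * camRot (A v) = 1 ∧ (camRot (A v)).det = 1) ∧
    (∀ v, v.val = 0 → camRot (A v) = 1 ∧ camTrans (A v) = 0) ∧
    ∀ v, v.val = 1 → camTrans (A v) 0 = 1}

namespace PointLineProblem

variable {m : ℕ} (P : PointLineProblem m)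

/-- The product of the variety of point-line arrangements in `ℙ³` and the camera variety. -/
def domain : Set (World P.p P.l m) :=
  {S | (∀ i j, P.inc i j → (S.pt i).submodule ≤ (S.line j).1) ∧ S.cam ∈ cameraVariety m}

/-! ### Joint images -/

/-- For each view, points and lines in `ℙ²` labelled by the observed points and lines. -/
structure Image where
  pt : ∀ v, P.obsPt v → ProjPoint 3
  line : ∀ v, P.obsLine v → ProjLine 3

/-- Coordinates on `P.Image`. -/
abbrev ImageIndex : Type :=
  ((Σ v, P.obsPt v) × Fin 3) ⊕ ((Σ v, P.obsLine v) × Fin 2 × Fin 3)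

/-- Coordinate vectors that describe an element of `P.Image`. -/
def imageCoords : Set (P.ImageIndex → ℂ) :=
  {b | (∀ i, (fun c => b (.inl (i, c))) ≠ 0) ∧
    ∀ j, LinearIndependent ℂ fun (r : Fin 2) (c : Fin 3) => b (.inr (j, r, c))}

/-- The element of `P.Image` with the given coordinates. -/
def imageOfCoords (b : P.imageCoords) : P.Image where
  pt v i := Projectivization.mk ℂ (fun c => b.1 (.inl (⟨v, i⟩, c))) (b.2.1 ⟨v, i⟩)
  line v j := ProjLine.span (fun r c => b.1 (.inr (⟨v, j⟩, r, c))) (b.2.2 ⟨v, j⟩)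

instance : TopologicalSpace P.Image :=
  zariskiQuotient P.imageCoords P.imageOfCoords

/-- The image variety: incidences of jointly observed points and lines hold in each view. -/
def imageVariety : Set P.Image :=
  {y | ∀ v (i : P.obsPt v) (j : P.obsLine v),
    P.inc i j → (y.pt v i).submodule ≤ (y.line v j).1}

/-- The (rational) joint camera map is defined at `S` and sends it to `y`. Since `y.pt v i` is a
point and `y.line v j` a line, the equations force that no observed point is the centre of the
observing camera and that no observed line passes through that centre. -/
def IsJointImage (S : World P.p P.l m) (y : P.Image) : Prop :=
  (∀ v (i : P.obsPt v),
    (y.pt v i).submodule = (S.pt i).submodule.map (S.cam v).mulVecLin) ∧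
  ∀ v (j : P.obsLine v), (y.line v j).1 = (S.line j).1.map (S.cam v).mulVecLin

/-- The preimage of `y` under the joint camera map. -/
def solutions (y : P.Image) : Set (World P.p P.l m) :=
  {S | S ∈ P.domain ∧ P.IsJointImage S y}

/-! ### Minimality and degree -/

/-- The joint camera map is dominant. -/
def IsDominant : Prop := Generically P.imageVariety fun y => (P.solutions y).Nonempty

/-- A generic joint image has a nonzero finite number of solutions. -/
def IsMinimal : Prop :=
  P.IsDominant ∧ Generically P.imageVariety fun y => (P.solutions y).Finite

/-- A generic joint image has exactly `d` complex solutions. -/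
def HasDegree (d : ℕ) : Prop :=
  Generically P.imageVariety fun y => (P.solutions y).encard = d

/-! ### Reducibility -/

variable {P}

/-- `P'` is obtained from `P` by forgetting points and lines; the embeddings list the points and
lines that are kept. -/
structure Forgetting (P P' : PointLineProblem m) where
  keptPt : Fin P'.p ↪ Fin P.p
  keptLine : Fin P'.l ↪ Fin P.l
  inc_iff : ∀ i j, P'.inc i j ↔ P.inc (keptPt i) (keptLine j)
  obsPt_iff : ∀ v i, i ∈ P'.obsPt v ↔ keptPt i ∈ P.obsPt v
  obsLine_iff : ∀ v j, j ∈ P'.obsLine v ↔ keptLine j ∈ P.obsLine v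

namespace Forgetting

variable {P' : PointLineProblem m} (F : Forgetting P P')

/-- The projection between the domains of the joint camera maps. -/
def onWorld (S : World P.p P.l m) : World P'.p P'.l m where
  pt i := S.pt (F.keptPt i)
  line j := S.line (F.keptLine j)
  cam := S.cam

/-- The projection between the codomains of the joint camera maps. -/
def onImage (y : P.Image) : P'.Image where
  pt v i := y.pt v ⟨F.keptPt i, (F.obsPt_iff v i).1 i.2⟩
  line v j := y.line v ⟨F.keptLine j, (F.obsLine_iff v j).1 j.2⟩

/-- For each forgotten point, at most one of its pins is kept. -/
def IsFeasible : Prop :=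
  ∀ i, i ∉ Set.range F.keptPt → ∀ j j',
    P.inc i (F.keptLine j) → P.inc i (F.keptLine j') → j = j'

/-- A generic solution `S'` of `P'`, with joint image `y'`, can be lifted to a solution of `P` for
generic `y` in the fibre over `y'`. -/
def HasLifting : Prop :=
  Generically P'.domain fun S' => ∃ y', P'.IsJointImage S' y' ∧
    Generically {y | y ∈ P.imageVariety ∧ F.onImage y = y'} fun y =>
      ∃ S ∈ P.solutions y, F.onWorld S = S'

end Forgetting

/-- `P` is reducible to `P'`. -/
def IsReducibleTo (P P' : PointLineProblem m) : Prop :=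
  ∃ F : Forgetting P P', F.IsFeasible ∧ F.HasLifting

end PointLineProblem

end

/-! Genericity is turned into nonemptiness of open sets in affine spaces. In a PL1P each line
carries at most one point, so an arrangement is free data: a vector for each point, and for each
line a second vector besides that of its point, or two vectors if it carries no point. With
quaternions for the rotations, the domain and the image variety are thus parametrized by nonempty
open subsets of affine spaces, where any two nonempty open sets meet, and the joint camera map
becomes polynomial (`generically_imageVariety_iff`, `mem_solutions_iff`).

A degree exists: by a form of Chevalley's theorem (`Cstr.projection_dichotomy`), having at least `n`
solutions is generically true or generically false. If it were generically true for all `n`, Baire's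
theorem would give one joint image with finitely many solutions and yet at least `n` for every `n`
(`exists_hasDegree`).

Let `d` be the degree of `P`, let `y'` be a generic joint image of `P'` and `y` a generic point of
the fibre over `y'`. Forgetting maps the `d` solutions of `y` to solutions of `y'`, and injectively:
two solutions with equal cameras would span a pencil of solutions (`eq_of_cam_eq`). So `y'` has at
least `d` solutions (`encard_solutions_le`). Conversely, a solution of `y'` in the open set where
lifting is possible lifts for all `y` in a dense open part of the fibre. Feasibility turns the
projection of joint images into a projection of coordinates, so the fibre is irreducible, and `d +
1` such solutions would lift over a common `y` that has only `d` (`encard_inter_le`).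

The solutions outside that open set remain. `solutions_subset_of_finite` excludes them without
dimension theory. In each chart they lie in the zero set of a rational function; by
`avoids_or_infinite_values`, either the image of this zero set misses a nonempty open set, or the
function takes infinitely many values on a generic fibre. Its nonzero values come from solutions
inside the open set, of which there are at most `d`, so the second case is impossible. -/

section

open MvPolynomial
open scoped Topology

/-! ### Polynomial functions and Zariski-open sets -/

/-- `F` is a polynomial function on `ℂ^σ`. -/
def IsPolyFun {σ : Type} (F : (σ → ℂ) → ℂ) : Prop :=
  ∃ p : MvPolynomial σ ℂ, ∀ x, F x = eval x p

namespace IsPolyFun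

variable {σ τ : Type} {F G : (σ → ℂ) → ℂ}

theorem of_eval (p : MvPolynomial σ ℂ) : IsPolyFun fun x => eval x p := ⟨p, fun _ => rfl⟩

theorem const (a : ℂ) : IsPolyFun fun _ : σ → ℂ => a := ⟨C a, by simp⟩

theorem coord (i : σ) : IsPolyFun fun x => x i := ⟨X i, by simp⟩

theorem add (hF : IsPolyFun F) (hG : IsPolyFun G) : IsPolyFun fun x => F x + G x := by
  obtain ⟨p, hp⟩ := hF
  obtain ⟨q, hq⟩ := hG
  exact ⟨p + q, by simp [hp, hq]⟩

theorem mul (hF : IsPolyFun F) (hG : IsPolyFun G) : IsPolyFun fun x => F x * G x := by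
  obtain ⟨p, hp⟩ := hF
  obtain ⟨q, hq⟩ := hG
  exact ⟨p * q, by simp [hp, hq]⟩

theorem sub (hF : IsPolyFun F) (hG : IsPolyFun G) : IsPolyFun fun x => F x - G x := by
  obtain ⟨p, hp⟩ := hF
  obtain ⟨q, hq⟩ := hG
  exact ⟨p - q, by simp [hp, hq]⟩

theorem pow (hF : IsPolyFun F) (n : ℕ) : IsPolyFun fun x => F x ^ n := by
  obtain ⟨p, hp⟩ := hF
  exact ⟨p ^ n, by simp [hp]⟩

theorem sum {ι : Type*} (s : Finset ι) {F : ι → (σ → ℂ) → ℂ} (hF : ∀ i, IsPolyFun (F i)) :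
    IsPolyFun fun x => ∑ i ∈ s, F i x := by
  choose p hp using hF
  exact ⟨∑ i ∈ s, p i, by simp [hp]⟩

theorem comp {F : (τ → ℂ) → ℂ} (hF : IsPolyFun F) {Φ : (σ → ℂ) → τ → ℂ}
    (hΦ : ∀ i, IsPolyFun fun x => Φ x i) : IsPolyFun fun x => F (Φ x) := by
  obtain ⟨p, hp⟩ := hF
  choose q hq using hΦ
  refine ⟨bind₁ q p, fun x => ?_⟩
  have hΦ : Φ x = fun i => eval x (q i) := funext fun i => hq i x
  change F (Φ x) = _
  rw [hp, hΦ]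
  exact (eval₂Hom_bind₁ _ _ _ _).symm

/-- The polynomial ring is a domain and `ℂ` is infinite, so a product of two nonzero polynomial
functions is not identically zero. This is the irreducibility of affine space on which all density
arguments rest. -/
theorem exists_ne_zero_and_ne_zero (hF : IsPolyFun F) (hG : IsPolyFun G) {x y : σ → ℂ}
    (hx : F x ≠ 0) (hy : G y ≠ 0) : ∃ z, F z ≠ 0 ∧ G z ≠ 0 := by
  obtain ⟨p, hp⟩ := hF
  obtain ⟨q, hq⟩ := hG
  by_contra! h
  have h0 : p * q = 0 := by
    refine MvPolynomial.funext fun z => ?_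
    rw [map_mul, ← hp, ← hq, map_zero]
    by_cases hz : F z = 0
    · simp [hz]
    · simp [h z hz]
  rcases mul_eq_zero.1 h0 with h0 | h0
  · exact hx (by simp [hp, h0])
  · exact hy (by simp [hq, h0])

end IsPolyFun

/-- Openness in the Zariski topology of `ℂ^σ`. -/
def ZOpen {σ : Type} (O : Set (σ → ℂ)) : Prop :=
  ∀ x ∈ O, ∃ F, IsPolyFun F ∧ F x ≠ 0 ∧ ∀ y, F y ≠ 0 → y ∈ O

namespace ZOpen

variable {σ τ : Type}

theorem ne_zero {F : (σ → ℂ) → ℂ} (hF : IsPolyFun F) : ZOpen {x | F x ≠ 0} :=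
  fun _ hx => ⟨F, hF, hx, fun _ hy => hy⟩

theorem univ : ZOpen (Set.univ : Set (σ → ℂ)) :=
  fun _ _ => ⟨fun _ => 1, .const 1, one_ne_zero, fun _ _ => trivial⟩

theorem inter {O O' : Set (σ → ℂ)} (hO : ZOpen O) (hO' : ZOpen O') : ZOpen (O ∩ O') := by
  rintro x ⟨hx, hx'⟩
  obtain ⟨F, hF, hFx, h⟩ := hO x hx
  obtain ⟨F', hF', hFx', h'⟩ := hO' x hx'
  exact ⟨fun y => F y * F' y, hF.mul hF', mul_ne_zero hFx hFx',
    fun y hy => ⟨h y (left_ne_zero_of_mul hy), h' y (right_ne_zero_of_mul hy)⟩⟩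

theorem iUnion {ι : Sort*} {O : ι → Set (σ → ℂ)} (hO : ∀ i, ZOpen (O i)) : ZOpen (⋃ i, O i) := by
  intro x hx
  obtain ⟨i, hi⟩ := Set.mem_iUnion.1 hx
  obtain ⟨F, hF, hFx, h⟩ := hO i x hi
  exact ⟨F, hF, hFx, fun y hy => Set.mem_iUnion.2 ⟨i, h y hy⟩⟩

theorem iInter {ι : Type*} [Finite ι] {O : ι → Set (σ → ℂ)} (hO : ∀ i, ZOpen (O i)) :
    ZOpen (⋂ i, O i) := by
  classical
  have := Fintype.ofFinite ι
  intro x hx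
  rw [Set.mem_iInter] at hx
  choose F hF hFx h using fun i => hO i x (hx i)
  choose p hp using hF
  refine ⟨fun y => eval y (∏ i, p i), .of_eval _, ?_, fun y hy => ?_⟩
  · simp only [map_prod, ← hp]
    exact Finset.prod_ne_zero_iff.2 fun i _ => hFx i
  · simp only [map_prod, ← hp] at hy
    exact Set.mem_iInter.2 fun i => h i y (Finset.prod_ne_zero_iff.1 hy i (Finset.mem_univ i))

theorem preimage {O : Set (τ → ℂ)} (hO : ZOpen O) {Φ : (σ → ℂ) → τ → ℂ}
    (hΦ : ∀ i, IsPolyFun fun x => Φ x i) : ZOpen (Φ ⁻¹' O) := by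
  intro x hx
  obtain ⟨F, hF, hFx, h⟩ := hO _ hx
  exact ⟨fun y => F (Φ y), hF.comp hΦ, hFx, fun y hy => h _ hy⟩

theorem inter_nonempty {O O' : Set (σ → ℂ)} (hO : ZOpen O) (hO' : ZOpen O')
    (h : O.Nonempty) (h' : O'.Nonempty) : (O ∩ O').Nonempty := by
  obtain ⟨x, hx⟩ := h
  obtain ⟨y, hy⟩ := h'
  obtain ⟨F, hF, hFx, hFO⟩ := hO x hx
  obtain ⟨G, hG, hGy, hGO⟩ := hO' y hy
  obtain ⟨z, hz⟩ := hF.exists_ne_zero_and_ne_zero hG hFx hGy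
  exact ⟨z, hFO z hz.1, hGO z hz.2⟩

/-- The zero set of a nonzero polynomial has no interior for the analytic topology, and `ℂ^σ` is
a Baire space. -/
theorem iInter_nat_nonempty [Finite σ] {O : ℕ → Set (σ → ℂ)} (hO : ∀ n, ZOpen (O n))
    (h : ∀ n, (O n).Nonempty) : (⋂ n, O n).Nonempty := by
  have := Fintype.ofFinite σ
  choose x hx using h
  choose F hF hFx hFO using fun n => hO n (x n) (hx n)
  choose p hp using hF
  have hopen : ∀ n, IsOpen {y : σ → ℂ | eval y (p n) ≠ 0} := fun n =>
    isOpen_ne_fun (MvPolynomial.continuous_eval (p n)) continuous_const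
  have hdense : ∀ n, Dense {y : σ → ℂ | eval y (p n) ≠ 0} := by
    intro n
    rw [← Set.compl_ofPred, ← interior_eq_empty_iff_dense_compl, Set.eq_empty_iff_forall_notMem]
    intro y hy
    obtain ⟨ε, hε, hball⟩ := Metric.isOpen_iff.1 isOpen_interior y hy
    have h0 : p n = 0 := by
      -- A ball for the sup norm is a product of infinite sets, and a polynomial vanishing on such a
      -- product is zero.
      refine MvPolynomial.funext_set (fun i => Metric.ball (y i) ε) (fun i => ?_) fun z hz => ?_
      · exact infinite_of_mem_nhds (y i) (Metric.ball_mem_nhds _ hε)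
      · rw [map_zero]
        have hz' : z ∈ Metric.ball y ε := by rwa [ball_pi _ hε]
        simpa using interior_subset (hball hz')
    exact hFx n (by rw [hp, h0, map_zero])
  obtain ⟨y, hy⟩ := (dense_iInter_of_isOpen hopen hdense).nonempty
  refine ⟨y, Set.mem_iInter.2 fun n => hFO n y ?_⟩
  rw [hp]
  exact Set.mem_iInter.1 hy n

end ZOpen

/-! ### Constructible sets and their projections -/

/-- Finite unions of sets defined by polynomial equations and one inequation. -/
def Cstr {σ : Type} (S : Set (σ → ℂ)) : Prop :=
  ∃ L : List (Set (MvPolynomial σ ℂ) × MvPolynomial σ ℂ),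
    ∀ x, x ∈ S ↔ ∃ b ∈ L, (∀ p ∈ b.1, eval x p = 0) ∧ eval x b.2 ≠ 0

namespace Cstr

variable {σ : Type} {S T : Set (σ → ℂ)}

theorem eq_zero {F : (σ → ℂ) → ℂ} (hF : IsPolyFun F) : Cstr {x | F x = 0} := by
  obtain ⟨p, hp⟩ := hF
  exact ⟨[({p}, 1)], by simp [hp]⟩

theorem ne_zero {F : (σ → ℂ) → ℂ} (hF : IsPolyFun F) : Cstr {x | F x ≠ 0} := by
  obtain ⟨p, hp⟩ := hF
  exact ⟨[(∅, p)], by simp [hp]⟩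

theorem eq {F G : (σ → ℂ) → ℂ} (hF : IsPolyFun F) (hG : IsPolyFun G) : Cstr {x | F x = G x} := by
  simpa only [sub_eq_zero] using eq_zero (hF.sub hG)

theorem ne {F G : (σ → ℂ) → ℂ} (hF : IsPolyFun F) (hG : IsPolyFun G) : Cstr {x | F x ≠ G x} := by
  simpa only [sub_ne_zero] using ne_zero (hF.sub hG)

theorem union (hS : Cstr S) (hT : Cstr T) : Cstr (S ∪ T) := by
  obtain ⟨L, hL⟩ := hS
  obtain ⟨M, hM⟩ := hT
  refine ⟨L ++ M, fun x => ?_⟩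
  simp only [Set.mem_union, hL, hM, List.mem_append, or_and_right, exists_or]

theorem inter (hS : Cstr S) (hT : Cstr T) : Cstr (S ∩ T) := by
  obtain ⟨L, hL⟩ := hS
  obtain ⟨M, hM⟩ := hT
  refine ⟨(L.product M).map fun b => (b.1.1 ∪ b.2.1, b.1.2 * b.2.2), fun x => ?_⟩
  simp only [Set.mem_inter_iff, hL, hM, List.mem_map, List.pair_mem_product, Prod.exists]
  constructor
  · rintro ⟨⟨a, b, hab, h1, h2⟩, a', b', hab', h1', h2'⟩
    refine ⟨_, _, ⟨a, b, a', b', ⟨hab, hab'⟩, rfl⟩, ?_, ?_⟩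
    · rintro p (hp | hp)
      exacts [h1 p hp, h1' p hp]
    · simpa using ⟨h2, h2'⟩
  · rintro ⟨_, _, ⟨a, b, a', b', ⟨hab, hab'⟩, h⟩, h1, h2⟩
    obtain ⟨rfl, rfl⟩ := Prod.mk.inj h
    simp only [map_mul, ne_eq, mul_eq_zero, not_or] at h2
    exact ⟨⟨a, b, hab, fun p hp => h1 p (.inl hp), h2.1⟩,
      a', b', hab', fun p hp => h1 p (.inr hp), h2.2⟩

theorem univ : Cstr (Set.univ : Set (σ → ℂ)) := by
  simpa using eq_zero (σ := σ) (.const 0)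

theorem empty : Cstr (∅ : Set (σ → ℂ)) := by
  simpa using ne_zero (σ := σ) (.const 0)

theorem iUnion {ι : Type*} [Finite ι] {S : ι → Set (σ → ℂ)} (hS : ∀ i, Cstr (S i)) :
    Cstr (⋃ i, S i) := by
  classical
  have := Fintype.ofFinite ι
  suffices h : ∀ s : Finset ι, Cstr (⋃ i ∈ s, S i) by simpa using h Finset.univ
  intro s
  induction s using Finset.induction_on with
  | empty => simpa using empty
  | insert a s _ ih => simpa only [Finset.set_biUnion_insert] using (hS a).union ih

theorem iInter {ι : Type*} [Finite ι] {S : ι → Set (σ → ℂ)} (hS : ∀ i, Cstr (S i)) :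
    Cstr (⋂ i, S i) := by
  classical
  have := Fintype.ofFinite ι
  suffices h : ∀ s : Finset ι, Cstr (⋂ i ∈ s, S i) by simpa using h Finset.univ
  intro s
  induction s using Finset.induction_on with
  | empty => simpa using univ
  | insert a s _ ih => simpa only [Finset.set_biInter_insert] using (hS a).inter ih

theorem preimage {τ : Type} {S : Set (τ → ℂ)} (hS : Cstr S) {Φ : (σ → ℂ) → τ → ℂ}
    (hΦ : ∀ i, IsPolyFun fun x => Φ x i) : Cstr (Φ ⁻¹' S) := by
  obtain ⟨L, hL⟩ := hS
  choose q hq using hΦ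
  have heval : ∀ x p, eval x (bind₁ q p) = eval (Φ x) p := by
    intro x p
    rw [show Φ x = fun i => eval x (q i) from funext fun i => hq i x]
    exact eval₂Hom_bind₁ _ _ _ _
  refine ⟨L.map fun b => (bind₁ q '' b.1, bind₁ q b.2), fun x => ?_⟩
  rw [Set.mem_preimage, hL]
  simp only [List.mem_map, exists_exists_and_eq_and, Set.forall_mem_image, heval]

end Cstr

/-- A surjection onto an algebraically closed field extends to integral extensions. -/
theorem exists_ringHom_extension_of_isIntegral {R S k : Type*} [CommRing R] [CommRing S] [Field k]
    [IsAlgClosed k] [Algebra R S] [Algebra.IsIntegral R S] (φ : R →+* k)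
    (hφ : Function.Surjective φ) (hker : RingHom.ker (algebraMap R S) ≤ RingHom.ker φ) :
    ∃ ψ : S →+* k, ψ.comp (algebraMap R S) = φ := by
  have := RingHom.ker_isMaximal_of_surjective φ hφ
  obtain ⟨Q, hQ, hQφ⟩ := Ideal.exists_ideal_over_maximal_of_isIntegral (S := S) (RingHom.ker φ) hker
  let e := RingHom.quotientKerEquivOfSurjective hφ
  -- This is the residue field extension over `k ≃ R ⧸ ker φ`. It is integral and `k` is
  -- algebraically closed, so it is an isomorphism; its inverse gives `ψ`.
  let f : k →+* S ⧸ Q := (Ideal.quotientMap Q (algebraMap R S) hQφ.ge).comp e.symm.toRingHom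
  have hf : f.IsIntegral := by
    refine RingHom.IsIntegral.trans _ _ (RingHom.isIntegral_of_surjective _ e.symm.surjective) ?_
    intro x
    obtain ⟨s, rfl⟩ := Ideal.Quotient.mk_surjective x
    obtain ⟨p, hp, hs⟩ := Algebra.IsIntegral.isIntegral (R := R) s
    refine ⟨p.map (Ideal.Quotient.mk _), hp.map _, ?_⟩
    rw [Polynomial.eval₂_map, Ideal.quotientMap_comp_mk, ← Polynomial.hom_eval₂, hs, map_zero]
  have hbij := IsAlgClosed.ringHom_bijective_of_isIntegral f hf
  let g := RingEquiv.ofBijective f hbij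
  refine ⟨g.symm.toRingHom.comp (Ideal.Quotient.mk Q), RingHom.ext fun r => ?_⟩
  change g.symm (Ideal.Quotient.mk Q (algebraMap R S r)) = φ r
  rw [RingEquiv.symm_apply_eq]
  change _ = Ideal.quotientMap Q (algebraMap R S) hQφ.ge (e.symm (φ r))
  have : e.symm (φ r) = Ideal.Quotient.mk _ r := by
    rw [RingEquiv.symm_apply_eq]; rfl
  rw [this, Ideal.quotientMap_mk]

/-! ### Generic specialization and Chevalley's dichotomy -/

section Chevalley

variable {σ τ : Type}

/-- A polynomial in two groups of variables, as a polynomial in the second group whose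
coefficients are polynomials in the first. -/
noncomputable def splitVars (σ τ : Type) : MvPolynomial (σ ⊕ τ) ℂ →ₐ[ℂ] MvPolynomial τ (MvPolynomial σ ℂ) :=
  aeval (Sum.elim (fun i => C (X i)) X)

theorem eval_sumElim (c : σ → ℂ) (s : τ → ℂ) (p : MvPolynomial (σ ⊕ τ) ℂ) :
    eval (Sum.elim c s) p = eval₂Hom (eval c) s (splitVars σ τ p) := by
  induction p using MvPolynomial.induction_on with
  | C a => simp [splitVars, MvPolynomial.algebraMap_eq, MvPolynomial.algebraMap_apply]
  | add p q hp hq => simp only [map_add, hp, hq]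
  | mul_X p i hp => cases i <;> simp only [map_mul, hp] <;> simp [splitVars]

/-- A solution in an algebraic extension of the polynomial ring specializes to solutions over the
points of a nonempty open set. -/
theorem exists_specialization [Finite τ]
    {Ω : Type} [Field Ω] [Algebra (MvPolynomial σ ℂ) Ω]
    [Algebra.IsAlgebraic (MvPolynomial σ ℂ) Ω]
    (hinj : Function.Injective (algebraMap (MvPolynomial σ ℂ) Ω)) (θ : τ → Ω)
    (E : Set (MvPolynomial τ (MvPolynomial σ ℂ))) (g : MvPolynomial τ (MvPolynomial σ ℂ))
    (hE : ∀ p ∈ E, aeval θ p = 0) (hg : aeval θ g ≠ 0) :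
    ∃ y : MvPolynomial σ ℂ, y ≠ 0 ∧ ∀ c, eval c y ≠ 0 →
      ∃ s : τ → ℂ, (∀ p ∈ E, eval₂Hom (eval c) s p = 0) ∧ eval₂Hom (eval c) s g ≠ 0 := by
  classical
  have := Fintype.ofFinite τ
  -- One denominator `y` serves all `θ i` and the inverse of `g(θ)`. Making this inverse integral
  -- too is what keeps `g` nonzero after specialization.
  obtain ⟨y, hy, hint⟩ := Algebra.IsAlgebraic.exists_integral_multiples (MvPolynomial σ ℂ)
    (insert (aeval θ g)⁻¹ (Finset.univ.image θ))
  refine ⟨y, hy, fun c hc => ?_⟩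
  let S := Localization.Away y
  have hyΩ : IsUnit (algebraMap (MvPolynomial σ ℂ) Ω y) :=
    isUnit_iff_ne_zero.2 fun h => hy (hinj (by rw [h, map_zero]))
  let lΩ : S →+* Ω := IsLocalization.Away.lift y hyΩ
  let _ : Algebra S Ω := lΩ.toAlgebra
  have htower : IsScalarTower (MvPolynomial σ ℂ) S Ω :=
    IsScalarTower.of_algebraMap_eq fun x => (IsLocalization.Away.lift_eq y hyΩ x).symm
  have hlinj : Function.Injective (algebraMap S Ω) := by
    rw [injective_iff_map_eq_zero]
    intro x hx
    obtain ⟨⟨a, b⟩, hab⟩ := IsLocalization.surj (Submonoid.powers y) x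
    have h1 : algebraMap (MvPolynomial σ ℂ) Ω a = 0 := by
      rw [IsScalarTower.algebraMap_apply (MvPolynomial σ ℂ) S Ω]
      simp only at hab
      rw [← hab, map_mul, hx, zero_mul]
    have h2 : a = 0 := hinj (by rw [h1, map_zero])
    simp only [h2, map_zero] at hab
    exact (IsUnit.mul_left_eq_zero (IsLocalization.map_units S b)).1 hab
  have hcu : IsUnit (eval c y) := isUnit_iff_ne_zero.2 hc
  let φ : S →+* ℂ := IsLocalization.Away.lift y hcu
  have hφ : ∀ a, φ (algebraMap _ S a) = eval c a := IsLocalization.Away.lift_eq y hcu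
  have hφs : Function.Surjective φ := fun a => ⟨algebraMap _ S (C a), by rw [hφ, eval_C]⟩
  have hSint : ∀ x : Ω, IsIntegral (MvPolynomial σ ℂ) (y • x) → IsIntegral S x := by
    intro x hx
    have h1 : IsIntegral S (y • x) := hx.tower_top
    obtain ⟨u, hu⟩ := IsLocalization.Away.algebraMap_isUnit (S := S) y
    have h2 : x = (↑u⁻¹ : S) • (y • x) := by
      rw [← algebraMap_smul S y x, ← hu, smul_smul, Units.inv_mul, one_smul]
    rw [h2]
    exact h1.smul _
  let D := integralClosure S Ω
  -- Evaluation at `c` is defined on `S` because `y` does not vanish at `c`; it extends to the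
  -- integral closure, which contains the solution and the inverse.
  obtain ⟨ψ, hψ⟩ := exists_ringHom_extension_of_isIntegral (S := D) φ hφs (by
    rw [(RingHom.injective_iff_ker_eq_bot _).1]
    · exact bot_le
    · exact fun a b hab => hlinj (congrArg Subtype.val hab))
  let θ' : τ → D := fun i => ⟨θ i, hSint _ (hint _ (by simp))⟩
  let w : D := ⟨(aeval θ g)⁻¹, hSint _ (hint _ (by simp))⟩
  have key : ∀ p : MvPolynomial τ (MvPolynomial σ ℂ), eval₂Hom (eval c) (fun i => ψ (θ' i)) p =
      ψ (eval₂ ((algebraMap S D).comp (algebraMap _ S)) θ' p) := by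
    intro p
    have hcomp : ψ.comp ((algebraMap S D).comp (algebraMap _ S)) = eval c :=
      RingHom.ext fun a => by rw [← hφ]; exact RingHom.congr_fun hψ (algebraMap _ S a)
    rw [MvPolynomial.hom_eval₂, hcomp]
    rfl
  have key2 : ∀ p : MvPolynomial τ (MvPolynomial σ ℂ), ((eval₂ ((algebraMap S D).comp (algebraMap _ S)) θ' p : D) : Ω) =
      aeval θ p := by
    intro p
    change (D.val : D →+* Ω) _ = _
    rw [MvPolynomial.hom_eval₂, aeval_def]
    congr 1
    refine RingHom.ext fun a => ?_
    rw [IsScalarTower.algebraMap_apply (MvPolynomial σ ℂ) S Ω]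
    rfl
  refine ⟨fun i => ψ (θ' i), fun p hp => ?_, ?_⟩
  · rw [key, (Subtype.ext (by rw [key2, hE p hp]; rfl) :
      eval₂ ((algebraMap S D).comp (algebraMap _ S)) θ' p = 0), map_zero]
  · rw [key]
    intro h0
    have h1 : eval₂ ((algebraMap S D).comp (algebraMap _ S)) θ' g * w = 1 :=
      Subtype.ext (by
        change ((eval₂ ((algebraMap S D).comp (algebraMap _ S)) θ' g : D) : Ω) * _ = 1
        rw [key2]; exact mul_inv_cancel₀ hg)
    have h2 := congrArg ψ h1
    rw [map_mul, h0, zero_mul, map_one] at h2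
    exact zero_ne_one h2

/-- If there is no solution over the algebraic closure of the function field, there is none over
the points of a nonempty open set. -/
theorem exists_no_specialization [Finite τ]
    (E : Set (MvPolynomial τ (MvPolynomial σ ℂ))) (g : MvPolynomial τ (MvPolynomial σ ℂ))
    (h : ∀ θ : τ → AlgebraicClosure (FractionRing (MvPolynomial σ ℂ)),
      (∀ p ∈ E, aeval θ p = 0) → aeval θ g = 0) :
    ∃ y : MvPolynomial σ ℂ, y ≠ 0 ∧ ∀ c, eval c y ≠ 0 →
      ∀ s : τ → ℂ, (∀ p ∈ E, eval₂Hom (eval c) s p = 0) → eval₂Hom (eval c) s g = 0 := by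
  set A := MvPolynomial σ ℂ
  set K := FractionRing A
  let ι : MvPolynomial τ A →+* MvPolynomial τ K := map (algebraMap A K)
  have hι : Function.Injective ι := map_injective _ (IsFractionRing.injective A K)
  have haeval : ∀ (θ : τ → AlgebraicClosure K) p, aeval θ (ι p) = aeval θ p :=
    fun θ p => aeval_map_algebraMap K θ p
  -- Nullstellensatz over the fraction field: some power of `g` lies in the ideal generated by `E`.
  have hrad : ι g ∈ ((Ideal.span E).map ι).radical := by
    rw [← vanishingIdeal_zeroLocus_eq_radical (K := AlgebraicClosure K)]
    intro θ hθ
    rw [haeval]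
    refine h θ fun p hp => ?_
    rw [← haeval]
    exact hθ _ (Ideal.mem_map_of_mem ι (Ideal.subset_span hp))
  obtain ⟨n, hn⟩ := hrad
  let _ : Algebra (MvPolynomial τ A) (MvPolynomial τ K) := ι.toAlgebra
  have : IsLocalization ((nonZeroDivisors A).map (C (σ := τ))) (MvPolynomial τ K) :=
    MvPolynomial.isLocalization (nonZeroDivisors A) K
  -- Clearing denominators puts `g ^ n * C f` into the ideal over the polynomial ring itself, so the
  -- membership can be specialized wherever `f` does not vanish.
  obtain ⟨⟨⟨a, ha⟩, ⟨_, f, hf, rfl⟩⟩, hab⟩ :=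
    (IsLocalization.mem_map_algebraMap_iff ((nonZeroDivisors A).map (C (σ := τ)))
      (MvPolynomial τ K)).1 hn
  have hab' : g ^ n * C f = a := hι (by rw [map_mul, map_pow]; exact hab)
  refine ⟨f, nonZeroDivisors.ne_zero hf, fun c hc s hs => ?_⟩
  have h1 : eval₂Hom (eval c) s a = 0 := by
    have : Ideal.span E ≤ RingHom.ker (eval₂Hom (eval c) s) := Ideal.span_le.2 hs
    exact this ha
  rw [← hab', map_mul, map_pow, mul_eq_zero] at h1
  rcases h1 with h1 | h1
  · exact eq_zero_of_pow_eq_zero h1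
  · exact absurd (by simpa using h1) hc

/-- The projection of a constructible set contains or avoids a nonempty open set. -/
theorem Cstr.projection_dichotomy [Finite τ] {S : Set (σ ⊕ τ → ℂ)} (hS : Cstr S) :
    (∃ O : Set (σ → ℂ), ZOpen O ∧ O.Nonempty ∧ ∀ c ∈ O, ∃ s, Sum.elim c s ∈ S) ∨
      ∃ O : Set (σ → ℂ), ZOpen O ∧ O.Nonempty ∧ ∀ c ∈ O, ∀ s, Sum.elim c s ∉ S := by
  obtain ⟨L, hL⟩ := hS
  have hne : ∀ y : MvPolynomial σ ℂ, y ≠ 0 → {c | eval c y ≠ 0}.Nonempty := by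
    intro y hy
    by_contra h0
    rw [Set.not_nonempty_iff_eq_empty, Set.eq_empty_iff_forall_notMem] at h0
    exact hy (MvPolynomial.funext fun c => by simpa using h0 c)
  induction L generalizing S with
  | nil => exact .inr ⟨Set.univ, .univ, Set.univ_nonempty, fun c _ s hs => by simpa using (hL _).1 hs⟩
  | cons b L ih =>
    obtain ⟨E, g⟩ := b
    have ih' := @ih {x | ∃ b ∈ L, (∀ p ∈ b.1, eval x p = 0) ∧ eval x b.2 ≠ 0} fun x => Iff.rfl
    -- If the first piece has a solution over the closure of the function field, its projection
    -- already contains a nonempty open set. Otherwise it avoids one, and the remaining pieces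
    -- decide.
    by_cases hθ : ∃ θ : τ → AlgebraicClosure (FractionRing (MvPolynomial σ ℂ)),
        (∀ p ∈ splitVars σ τ '' E, aeval θ p = 0) ∧ aeval θ (splitVars σ τ g) ≠ 0
    · obtain ⟨θ, h1, h2⟩ := hθ
      have : Algebra.IsAlgebraic (MvPolynomial σ ℂ)
          (AlgebraicClosure (FractionRing (MvPolynomial σ ℂ))) :=
        (IsFractionRing.comap_isAlgebraic_iff (K := FractionRing (MvPolynomial σ ℂ))).2 inferInstance
      have hinj : Function.Injective (algebraMap (MvPolynomial σ ℂ)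
          (AlgebraicClosure (FractionRing (MvPolynomial σ ℂ)))) := by
        rw [IsScalarTower.algebraMap_eq (MvPolynomial σ ℂ) (FractionRing (MvPolynomial σ ℂ)),
          RingHom.coe_comp]
        exact (algebraMap (FractionRing (MvPolynomial σ ℂ)) _).injective.comp
          (IsFractionRing.injective (MvPolynomial σ ℂ) (FractionRing (MvPolynomial σ ℂ)))
      obtain ⟨y, hy, h3⟩ := exists_specialization hinj θ _ _ h1 h2
      refine .inl ⟨_, .ne_zero (.of_eval y), hne y hy, fun c hc => ?_⟩
      obtain ⟨s, hs1, hs2⟩ := h3 c hc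
      refine ⟨s, (hL _).2 ⟨_, List.mem_cons_self, fun p hp => ?_, ?_⟩⟩
      · rw [eval_sumElim]; exact hs1 _ ⟨p, hp, rfl⟩
      · rw [eval_sumElim]; exact hs2
    · push Not at hθ
      obtain ⟨y, hy, h3⟩ := exists_no_specialization _ _ hθ
      rcases ih' with ⟨O, hO, hOne, h⟩ | ⟨O, hO, hOne, h⟩
      · refine .inl ⟨O, hO, hOne, fun c hc => ?_⟩
        obtain ⟨s, b, hb, hs⟩ := h c hc
        exact ⟨s, (hL _).2 ⟨b, List.mem_cons_of_mem _ hb, hs⟩⟩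
      · refine .inr ⟨O ∩ {c | eval c y ≠ 0}, hO.inter (.ne_zero (.of_eval y)),
          hO.inter_nonempty (.ne_zero (.of_eval y)) hOne (hne y hy), fun c hc s hs => ?_⟩
        obtain ⟨b, hb, hs1, hs2⟩ := (hL _).1 hs
        rcases List.mem_cons.1 hb with rfl | hb
        · refine hs2 ?_
          rw [eval_sumElim]
          refine h3 c hc.2 s ?_
          rintro _ ⟨p, hp, rfl⟩
          rw [← eval_sumElim]
          exact hs1 p hp
        · exact h c hc.1 s ⟨b, hb, hs1, hs2⟩

end Chevalley

/-! ### Values of a rational function on generic fibres -/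

/-- Let `Ψ` be a polynomial map and `N / D` a rational function. Either `Ψ` maps the zero set of
`N / D` into a proper closed set, or `N / D` takes infinitely many values on a generic fibre of
`Ψ`. -/
theorem avoids_or_infinite_values {σ τ : Type} [Finite σ] [Finite τ] {Ψ : (σ → ℂ) → τ → ℂ}
    (hΨ : ∀ i, IsPolyFun fun s => Ψ s i) {O : Set (σ → ℂ)} (hO : ZOpen O) (hOc : Cstr O)
    {N D : (σ → ℂ) → ℂ} (hN : IsPolyFun N) (hD : IsPolyFun D) (hD0 : ∀ s ∈ O, D s ≠ 0)
    (hN0 : ∃ s ∈ O, N s ≠ 0) :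
    (∃ U : Set (τ → ℂ), ZOpen U ∧ U.Nonempty ∧ ∀ s ∈ O, N s = 0 → Ψ s ∉ U) ∨
      ∃ U : Set (τ → ℂ), ZOpen U ∧ U.Nonempty ∧
        ∀ c ∈ U, {t : ℂ | ∃ s ∈ O, Ψ s = c ∧ N s = t * D s}.Infinite := by
  let fib : ((τ ⊕ Unit) ⊕ σ → ℂ) → σ → ℂ := fun x i => x (.inr i)
  have hfib : ∀ i, IsPolyFun fun x => fib x i := fun i => .coord _
  -- The graph of `(Ψ, N / D)`, to be projected to the pairs `(c, t)` of a point and a value.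
  let Z : Set ((τ ⊕ Unit) ⊕ σ → ℂ) := {x | fib x ∈ O} ∩
    ((⋂ i, {x | Ψ (fib x) i = x (.inl (.inl i))}) ∩
      {x | N (fib x) = x (.inl (.inr ())) * D (fib x)})
  have hZ : Cstr Z := by
    exact .inter (hOc.preimage hfib) (.inter (.iInter fun i => .eq ((hΨ i).comp hfib) (.coord _))
      (.eq (hN.comp hfib) (.mul (.coord _) (hD.comp hfib))))
  have hmem : ∀ c t s, (Sum.elim (Sum.elim c fun _ => t) s : (τ ⊕ Unit) ⊕ σ → ℂ) ∈ Z ↔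
      s ∈ O ∧ Ψ s = c ∧ N s = t * D s := by
    intro c t s
    simp only [Z, Set.mem_inter_iff, Set.mem_iInter, funext_iff]
    rfl
  have hpoly : ∀ U : Set (τ ⊕ Unit → ℂ), ZOpen U → U.Nonempty →
      ∃ q : Polynomial (MvPolynomial τ ℂ), q ≠ 0 ∧
        ∀ c t, (q.map (eval c)).eval t ≠ 0 → (Sum.elim c fun _ => t) ∈ U := by
    rintro U hU ⟨x, hx⟩
    obtain ⟨F, ⟨p, hp⟩, hFx, hFU⟩ := hU x hx
    let Q : MvPolynomial (τ ⊕ Unit) ℂ →ₐ[ℂ] Polynomial (MvPolynomial τ ℂ) :=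
      aeval (Sum.elim (fun i => Polynomial.C (X i)) fun _ => Polynomial.X)
    have hQ : ∀ c t, ((Q p).map (eval c)).eval t = eval (Sum.elim c fun _ => t) p := by
      intro c t
      clear hp
      induction p using MvPolynomial.induction_on with
      | C a => simp [Q, Polynomial.algebraMap_apply, MvPolynomial.algebraMap_eq]
      | add p q hp hq => simp only [map_add, Polynomial.map_add, Polynomial.eval_add, hp, hq]
      | mul_X p i hp =>
        cases i <;> simp only [map_mul, Polynomial.map_mul, Polynomial.eval_mul, hp] <;> simp [Q]
    refine ⟨Q p, fun h0 => hFx ?_, fun c t h => hFU _ (by rw [hp, ← hQ]; exact h)⟩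
    have hx' : x = Sum.elim (fun i => x (.inl i)) fun _ => x (.inr ()) := by
      ext (i | i) <;> rfl
    rw [hp, hx', ← hQ, h0]
    simp
  have hne : ∀ a : MvPolynomial τ ℂ, a ≠ 0 → {c | eval c a ≠ 0}.Nonempty := by
    intro y hy
    by_contra h0
    rw [Set.not_nonempty_iff_eq_empty, Set.eq_empty_iff_forall_notMem] at h0
    exact hy (MvPolynomial.funext fun c => by simpa using h0 c)
  rcases hZ.projection_dichotomy with ⟨U, hU, hUne, h⟩ | ⟨U, hU, hUne, h⟩
  · right
    obtain ⟨q, hq, hqU⟩ := hpoly U hU hUne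
    refine ⟨_, .ne_zero (.of_eval q.leadingCoeff), hne _ (Polynomial.leadingCoeff_ne_zero.2 hq),
      fun c hc => ?_⟩
    have hqc : q.map (eval c) ≠ 0 := fun h0 => hc (by
      have := congrArg (fun r => r.coeff q.natDegree) h0
      simpa using this)
    -- Over such a `c` only the roots of a nonzero polynomial in one variable can be missing from
    -- the values.
    refine Set.Infinite.mono (s := {t | (q.map (eval c)).eval t = 0}ᶜ) (fun t ht => ?_)
      (Set.Finite.infinite_compl (Polynomial.finite_setOfPred_isRoot hqc))
    obtain ⟨s, hs⟩ := h _ (hqU c t ht)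
    exact ⟨s, (hmem c t s).1 hs⟩
  · left
    obtain ⟨q, hq, hqU⟩ := hpoly U hU hUne
    -- Split off the power of the value variable: `q` vanishes on all pairs `(Ψ s, N s / D s)` and
    -- `N` is nonzero generically, so `r` vanishes on these pairs generically, hence also where `N s
    -- = 0`. There it says that `r(Ψ s, 0) = 0`, a proper closed condition on `Ψ s`.
    obtain ⟨r, hqr, hr⟩ := Polynomial.exists_eq_pow_rootMultiplicity_mul_and_not_dvd q hq 0
    rw [Polynomial.dvd_iff_isRoot, Polynomial.IsRoot] at hr
    refine ⟨_, .ne_zero (.of_eval (r.eval 0)), hne _ hr, fun s hs hNs hU0 => ?_⟩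
    -- This is `r(Ψ s, N s / D s)` cleared of denominators; being polynomial, it can be handled by
    -- density.
    let G : (σ → ℂ) → ℂ := fun s => ∑ k ∈ Finset.range (r.natDegree + 1),
      eval (Ψ s) (r.coeff k) * (N s ^ k * D s ^ (r.natDegree - k))
    have hG : IsPolyFun G := .sum _ fun k =>
      ((IsPolyFun.of_eval _).comp hΨ).mul ((hN.pow k).mul (hD.pow _))
    have hG' : ∀ s ∈ O, G s = D s ^ r.natDegree * (r.map (eval (Ψ s))).eval (N s / D s) := by
      intro s hs
      rw [Polynomial.eval_map, Polynomial.eval₂_eq_sum_range, Finset.mul_sum]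
      refine Finset.sum_congr rfl fun k hk => ?_
      have hk' : r.natDegree = (r.natDegree - k) + k := by
        have := Finset.mem_range.1 hk
        omega
      have := hD0 s hs
      rw [div_pow]
      conv_rhs => rw [hk', pow_add]
      field_simp
    have hvan : ∀ s ∈ O, N s ≠ 0 → G s = 0 := by
      intro s hs hNs
      have h1 : (q.map (eval (Ψ s))).eval (N s / D s) = 0 := by
        by_contra h0
        exact h _ (hqU _ _ h0) s ((hmem _ _ _).2 ⟨hs, rfl, (div_mul_cancel₀ _ (hD0 s hs)).symm⟩)
      rw [hqr] at h1
      simp only [map_zero, sub_zero, Polynomial.map_mul, Polynomial.map_pow, Polynomial.map_X,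
        Polynomial.eval_mul, Polynomial.eval_pow, Polynomial.eval_X, mul_eq_zero] at h1
      rcases h1 with h1 | h1
      · exact absurd (eq_zero_of_pow_eq_zero h1) (div_ne_zero hNs (hD0 s hs))
      · rw [hG' s hs, h1, mul_zero]
    have hGs : G s ≠ 0 := by
      rw [hG' s hs, hNs, zero_div]
      refine mul_ne_zero (pow_ne_zero _ (hD0 s hs)) ?_
      rw [← Polynomial.coeff_zero_eq_eval_zero, Polynomial.coeff_map,
        Polynomial.coeff_zero_eq_eval_zero]
      exact hU0
    obtain ⟨s1, hs1, hNs1⟩ := hN0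
    obtain ⟨z, ⟨hz1, hz2⟩, hz3, hz4⟩ := (hO.inter (.ne_zero hG)).inter_nonempty
      (hO.inter (.ne_zero hN)) ⟨s, hs, hGs⟩ ⟨s1, hs1, hNs1⟩
    exact hz2 (hvan z hz1 hz4)

/-! ### Homogeneous coordinates of points and lines -/

section LinearAlgebra

variable {n : ℕ}

/-- The `2 × 2` minors of the matrix with rows `a`, `b`. -/
def minor (a b : Fin n → ℂ) (k l : Fin n) : ℂ := a k * b l - a l * b k

theorem linearIndependent_pair_iff_minor {a b : Fin n → ℂ} :
    LinearIndependent ℂ ![a, b] ↔ ∃ k l, minor a b k l ≠ 0 := by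
  rw [LinearIndependent.pair_iff]
  constructor
  · intro h
    by_contra! h0
    have ha : a = 0 := by
      funext k
      have := (h (-b k) (a k) (funext fun l => ?_)).2
      · exact this
      · have := h0 k l
        simp only [minor] at this
        simp only [Pi.add_apply, Pi.smul_apply, smul_eq_mul, Pi.zero_apply]
        linear_combination this
    exact one_ne_zero (h 1 0 (by simp [ha])).1
  · rintro ⟨k, l, hkl⟩ s t hst
    have hk := congrFun hst k
    have hl := congrFun hst l
    simp only [Pi.add_apply, Pi.smul_apply, smul_eq_mul, Pi.zero_apply] at hk hl
    simp only [minor] at hkl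
    constructor
    · refine (mul_eq_zero.1 (?_ : s * (a k * b l - a l * b k) = 0)).resolve_right hkl
      linear_combination b l * hk - b k * hl
    · refine (mul_eq_zero.1 (?_ : t * (a k * b l - a l * b k) = 0)).resolve_right hkl
      linear_combination a k * hl - a l * hk

theorem finrank_span_pair_eq_two_iff {a b : Fin n → ℂ} :
    Module.finrank ℂ (Submodule.span ℂ {a, b}) = 2 ↔ LinearIndependent ℂ ![a, b] := by
  rw [linearIndependent_iff_card_eq_finrank_span, Set.finrank]
  rw [Matrix.range_cons, Matrix.range_cons, Matrix.range_empty, Set.union_empty,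
    Set.singleton_union, Fintype.card_fin, eq_comm]

theorem span_pair_eq_of_linearIndependent {a b : Fin n → ℂ} {W : Submodule ℂ (Fin n → ℂ)}
    (hW : Module.finrank ℂ W = 2) (h : LinearIndependent ℂ ![a, b]) (ha : a ∈ W) (hb : b ∈ W) :
    W = Submodule.span ℂ {a, b} := by
  refine (Submodule.eq_of_le_of_finrank_eq (Submodule.span_le.2 ?_) ?_).symm
  · rintro x (rfl | rfl)
    exacts [ha, hb]
  · rw [hW, finrank_span_pair_eq_two_iff.2 h]

theorem ProjLine.linearIndependent {W : ProjLine n} {a b : Fin n → ℂ}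
    (h : W.1 = Submodule.span ℂ {a, b}) : LinearIndependent ℂ ![a, b] :=
  finrank_span_pair_eq_two_iff.1 (by rw [← h, W.2])

theorem ProjPoint.ne_zero {p : ProjPoint n} {x : Fin n → ℂ} (h : p.submodule = ℂ ∙ x) : x ≠ 0 := by
  rintro rfl
  have h1 := p.finrank_submodule
  rw [h, Submodule.span_zero_singleton, finrank_bot] at h1
  exact zero_ne_one h1

theorem ProjPoint.submodule_eq_span {p : ProjPoint n} {x : Fin n → ℂ} (hx : x ≠ 0)
    (h : x ∈ p.submodule) : p.submodule = ℂ ∙ x := by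
  refine (Submodule.eq_of_le_of_finrank_eq ?_ ?_).symm
  · rwa [Submodule.span_singleton_le_iff_mem]
  · rw [finrank_span_singleton hx, p.finrank_submodule]

theorem exists_span_pair_eq {W : Submodule ℂ (Fin n → ℂ)} (hW : Module.finrank ℂ W = 2)
    {x : Fin n → ℂ} (hx : x ≠ 0) (hxW : x ∈ W) : ∃ b, W = Submodule.span ℂ {x, b} := by
  have hlt : (ℂ ∙ x) < W := by
    refine lt_of_le_of_ne ((Submodule.span_singleton_le_iff_mem _ _).2 hxW) fun h => ?_
    rw [← h, finrank_span_singleton hx] at hW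
    omega
  obtain ⟨b, hb, hbx⟩ := SetLike.exists_of_lt hlt
  refine ⟨b, span_pair_eq_of_linearIndependent hW ?_ hxW hb⟩
  rw [LinearIndependent.pair_iff' hx]
  intro a ha
  exact hbx (ha ▸ Submodule.smul_mem _ _ (Submodule.mem_span_singleton_self x))

theorem exists_span_pair {W : Submodule ℂ (Fin n → ℂ)} (hW : Module.finrank ℂ W = 2) :
    ∃ a b, W = Submodule.span ℂ {a, b} := by
  have hne : W ≠ ⊥ := by
    rintro rfl
    simp at hW
  obtain ⟨x, hx, hx0⟩ := Submodule.exists_mem_ne_zero_of_ne_bot hne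
  exact ⟨x, exists_span_pair_eq hW hx0 hx⟩

theorem finite_setOf_add_smul_eq_zero {x : Fin n → ℂ} (hx : x ≠ 0) (x' : Fin n → ℂ) :
    {t : ℂ | x + t • x' = 0}.Finite := by
  refine Set.Subsingleton.finite fun t ht t' ht' => ?_
  by_contra hne
  have h1 : (t - t') • x' = 0 := by
    have := congrArg₂ (· - ·) (show x + t • x' = 0 from ht) (show x + t' • x' = 0 from ht')
    rw [sub_smul]
    simpa using this
  have h2 := (smul_eq_zero.1 h1).resolve_left (sub_ne_zero.2 hne)
  exact hx (by simpa [h2] using ht)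

/-- A minor that is nonzero at `t = 0` is a nonzero polynomial in `t`, so it has finitely many
roots. -/
theorem finite_setOf_not_linearIndependent {a b : Fin n → ℂ} (h : LinearIndependent ℂ ![a, b])
    (a' b' : Fin n → ℂ) : {t : ℂ | ¬ LinearIndependent ℂ ![a + t • a', b + t • b']}.Finite := by
  obtain ⟨k, l, hkl⟩ := linearIndependent_pair_iff_minor.1 h
  let p : Polynomial ℂ :=
    (.C (a k) + .X * .C (a' k)) * (.C (b l) + .X * .C (b' l)) -
      (.C (a l) + .X * .C (a' l)) * (.C (b k) + .X * .C (b' k))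
  have hp : p ≠ 0 := by
    intro h0
    have := congrArg (Polynomial.eval 0) h0
    exact hkl (by simpa [p, minor] using this)
  refine (Polynomial.finite_setOfPred_isRoot hp).subset fun t ht => ?_
  by_contra h0
  refine ht (linearIndependent_pair_iff_minor.2 ⟨k, l, fun h1 => h0 ?_⟩)
  simpa [p, minor, mul_comm t] using h1

/-- A line is the row space of its Plücker matrix. -/
theorem span_pair_eq_span_minor {a b : Fin n → ℂ} {k l : Fin n} (h : minor a b k l ≠ 0) :
    Submodule.span ℂ {a, b} = Submodule.span ℂ {minor a b k, minor a b l} := by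
  have hrow : ∀ m, minor a b m ∈ Submodule.span ℂ {a, b} := fun m =>
    Submodule.mem_span_pair.2 ⟨-b m, a m, funext fun i => by simp [minor]; ring⟩
  refine (Submodule.span_le.2 ?_).antisymm (Submodule.span_le.2 ?_)
  · have h1 : minor a b k l ≠ 0 := h
    simp only [minor] at h1
    rintro x (rfl | rfl)
    · refine Submodule.mem_span_pair.2
        ⟨x l * (minor x b k l)⁻¹, -x k * (minor x b k l)⁻¹, funext fun i => ?_⟩
      simp only [Pi.add_apply, Pi.smul_apply, smul_eq_mul, minor]
      linear_combination x i * mul_inv_cancel₀ h1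
    · refine Submodule.mem_span_pair.2
        ⟨x l * (minor a x k l)⁻¹, -x k * (minor a x k l)⁻¹, funext fun i => ?_⟩
      simp only [Pi.add_apply, Pi.smul_apply, smul_eq_mul, minor]
      linear_combination x i * mul_inv_cancel₀ h1
  · rintro x (rfl | rfl) <;> exact hrow _

/-- A change of basis multiplies all minors by one determinant, and conversely proportional Plücker
matrices have the same row space. Written with cross products, the criterion is polynomial in the
vectors. -/
theorem span_pair_eq_iff_minor {a b a' b' : Fin n → ℂ} (h : LinearIndependent ℂ ![a, b])
    (h' : LinearIndependent ℂ ![a', b']) :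
    Submodule.span ℂ {a, b} = Submodule.span ℂ {a', b'} ↔
      ∀ k l k' l', minor a b k l * minor a' b' k' l' = minor a b k' l' * minor a' b' k l := by
  constructor
  · intro hs k l k' l'
    have ha : a ∈ Submodule.span ℂ {a', b'} := hs ▸ Submodule.subset_span (by simp)
    have hb : b ∈ Submodule.span ℂ {a', b'} := hs ▸ Submodule.subset_span (by simp)
    obtain ⟨s, t, rfl⟩ := Submodule.mem_span_pair.1 ha
    obtain ⟨u, v, rfl⟩ := Submodule.mem_span_pair.1 hb
    simp only [minor, Pi.add_apply, Pi.smul_apply, smul_eq_mul]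
    ring
  · intro hm
    obtain ⟨k, l, hkl⟩ := linearIndependent_pair_iff_minor.1 h
    obtain ⟨k', l', hkl'⟩ := linearIndependent_pair_iff_minor.1 h'
    have hkl2 : minor a' b' k l ≠ 0 := fun h0 => by
      have := hm k l k' l'
      rw [h0, mul_zero] at this
      exact mul_ne_zero hkl hkl' this
    have hrow : ∀ m, minor a b m = (minor a b k l / minor a' b' k l) • minor a' b' m := by
      intro m
      funext i
      rw [Pi.smul_apply, smul_eq_mul, div_mul_eq_mul_div, eq_div_iff hkl2]
      exact (hm k l m i).symm
    rw [span_pair_eq_span_minor hkl, span_pair_eq_span_minor hkl2]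
    have hu : IsUnit (minor a b k l / minor a' b' k l) :=
      isUnit_iff_ne_zero.2 (div_ne_zero hkl hkl2)
    rw [hrow k, hrow l, Submodule.span_insert, Submodule.span_insert,
      Submodule.span_singleton_smul_eq hu, Submodule.span_singleton_smul_eq hu]

theorem span_singleton_eq_iff {x x' : Fin n → ℂ} (h : x ≠ 0) (h' : x' ≠ 0) :
    (ℂ ∙ x) = ℂ ∙ x' ↔ ∀ k l, minor x x' k l = 0 := by
  constructor
  · intro hs k l
    obtain ⟨t, rfl⟩ := Submodule.mem_span_singleton.1
      (hs ▸ Submodule.mem_span_singleton_self x : x ∈ ℂ ∙ x')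
    simp only [minor, Pi.smul_apply, smul_eq_mul]
    ring
  · intro hm
    obtain ⟨k, hk⟩ := Function.ne_iff.1 h'
    have hx : x = (x k / x' k) • x' := by
      funext l
      have := hm k l
      simp only [minor] at this
      rw [Pi.smul_apply, smul_eq_mul, div_mul_eq_mul_div, eq_div_iff hk]
      linear_combination -this
    have hu : x k / x' k ≠ 0 := fun h0 => h (by rw [hx, h0, zero_smul])
    rw [hx]
    exact Submodule.span_singleton_smul_eq (isUnit_iff_ne_zero.2 hu) _

end LinearAlgebra

/-! ### Coordinates adapted to incidences -/

/-- Index set of homogeneous coordinates of points labelled by `α` and of pairs of vectors that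
span lines labelled by `β`. -/
abbrev ConfigIndex (α β : Type) (n : ℕ) : Type := (α × Fin n) ⊕ (β × Fin 2 × Fin n)

section Config

variable {α β : Type} {n : ℕ}

/-- The coordinates of a point. -/
def ptVec (c : ConfigIndex α β n → ℂ) (i : α) : Fin n → ℂ := fun k => c (.inl (i, k))

/-- The two vectors attached to a line. -/
def lineVec (c : ConfigIndex α β n → ℂ) (j : β) (r : Fin 2) : Fin n → ℂ := fun k => c (.inr (j, r, k))

/-- The first spanning vector of a line: the point on the line, if there is one. -/
def fstVec (inc : β → Option α) (c : ConfigIndex α β n → ℂ) (j : β) : Fin n → ℂ :=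
  (inc j).elim (lineVec c j 0) (ptVec c)

/-- `c` represents the configuration of points `pt` and lines `line`. The coordinates
`lineVec c j 0` of a line `j` with `inc j ≠ none` are not used. -/
def Represents (inc : β → Option α) (c : ConfigIndex α β n → ℂ) (pt : α → ProjPoint n)
    (line : β → ProjLine n) : Prop :=
  (∀ i, (pt i).submodule = ℂ ∙ ptVec c i) ∧
    ∀ j, (line j).1 = Submodule.span ℂ {fstVec inc c j, lineVec c j 1}

/-- The coordinate vectors that represent a configuration. -/
def nondegenerate (inc : β → Option α) (n : ℕ) : Set (ConfigIndex α β n → ℂ) :=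
  {c | (∀ i, ∃ k, ptVec c i k ≠ 0) ∧ ∀ j, ∃ k l, minor (fstVec inc c j) (lineVec c j 1) k l ≠ 0}

variable {inc : β → Option α} {c : ConfigIndex α β n → ℂ} {pt pt' : α → ProjPoint n}
  {line line' : β → ProjLine n}

theorem isPolyFun_fstVec (j : β) (k : Fin n) : IsPolyFun fun c => fstVec inc c j k := by
  unfold fstVec
  cases inc j <;> exact .coord _

theorem isPolyFun_minor_fstVec (j : β) (k l : Fin n) :
    IsPolyFun fun c => minor (fstVec inc c j) (lineVec c j 1) k l :=
  ((isPolyFun_fstVec j k).mul (.coord _)).sub ((isPolyFun_fstVec j l).mul (.coord _))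

theorem zOpen_nondegenerate [Finite α] [Finite β] :
    ZOpen (nondegenerate inc n : Set (ConfigIndex α β n → ℂ)) := by
  have : (nondegenerate inc n : Set (ConfigIndex α β n → ℂ)) =
      (⋂ i, ⋃ k, {c | ptVec c i k ≠ 0}) ∩
        ⋂ j, ⋃ k, ⋃ l, {c | minor (fstVec inc c j) (lineVec c j 1) k l ≠ 0} := by
    ext c; simp [nondegenerate]
  rw [this]
  exact .inter (.iInter fun i => .iUnion fun k => .ne_zero (.coord _))
    (.iInter fun j => .iUnion fun k => .iUnion fun l => .ne_zero (isPolyFun_minor_fstVec j k l))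

theorem linearIndependent_of_mem_nondegenerate (h : c ∈ nondegenerate inc n) (j : β) :
    LinearIndependent ℂ ![fstVec inc c j, lineVec c j 1] :=
  linearIndependent_pair_iff_minor.2 (h.2 j)

theorem ptVec_ne_zero_of_mem_nondegenerate (h : c ∈ nondegenerate inc n) (i : α) :
    ptVec c i ≠ 0 :=
  Function.ne_iff.2 (h.1 i)

theorem nondegenerate_nonempty (hn : 2 ≤ n) (inc : β → Option α) :
    (nondegenerate inc n : Set (ConfigIndex α β n → ℂ)).Nonempty := by
  let k0 : Fin n := ⟨0, by omega⟩
  let k1 : Fin n := ⟨1, by omega⟩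
  have h01 : k0 ≠ k1 := by simp [k0, k1]
  refine ⟨Sum.elim (fun i => if i.2 = k0 then 1 else 0)
    fun j => if j.2.1 = 0 then (if j.2.2 = k0 then 1 else 0) else if j.2.2 = k1 then 1 else 0,
    fun i => ⟨k0, ?_⟩, fun j => ⟨k0, k1, ?_⟩⟩
  · simp [ptVec]
  · unfold fstVec
    cases inc j <;> simp [minor, lineVec, ptVec, h01, h01.symm]

theorem exists_represents_of_mem_nondegenerate (h : c ∈ nondegenerate inc n) :
    ∃ (pt : α → ProjPoint n) (line : β → ProjLine n), Represents inc c pt line :=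
  ⟨fun i => .mk ℂ (ptVec c i) (ptVec_ne_zero_of_mem_nondegenerate h i),
    fun j => ⟨Submodule.span ℂ {fstVec inc c j, lineVec c j 1},
      finrank_span_pair_eq_two_iff.2 (linearIndependent_of_mem_nondegenerate h j)⟩,
    fun _ => Projectivization.submodule_mk _ _, fun _ => rfl⟩

namespace Represents

theorem mem_nondegenerate (h : Represents inc c pt line) : c ∈ nondegenerate inc n :=
  ⟨fun i => Function.ne_iff.1 (ProjPoint.ne_zero (h.1 i)),
    fun j => linearIndependent_pair_iff_minor.1 (ProjLine.linearIndependent (h.2 j))⟩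

theorem unique (h : Represents inc c pt line) (h' : Represents inc c pt' line') :
    pt = pt' ∧ line = line' := by
  constructor
  · funext i
    refine Projectivization.submodule_injective ?_
    rw [h.1, h'.1]
  · funext j
    refine Subtype.ext ?_
    rw [h.2, h'.2]

theorem incident (h : Represents inc c pt line) {i : α} {j : β} (hij : inc j = some i) :
    (pt i).submodule ≤ (line j).1 := by
  rw [h.1, h.2, Submodule.span_singleton_le_iff_mem]
  exact Submodule.subset_span (by simp [fstVec, hij])

theorem fstVec_mem (h : Represents inc c pt line) (j : β) : fstVec inc c j ∈ (line j).1 := by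
  rw [h.2]
  exact Submodule.subset_span (by simp)

theorem lineVec_mem (h : Represents inc c pt line) (j : β) : lineVec c j 1 ∈ (line j).1 := by
  rw [h.2]
  exact Submodule.subset_span (by simp)

theorem ptVec_mem (h : Represents inc c pt line) (i : α) : ptVec c i ∈ (pt i).submodule := by
  rw [h.1]
  exact Submodule.mem_span_singleton_self _

end Represents

/-- A line through a point has a basis that starts with the chosen vector of this point. Since `inc`
assigns at most one point to a line, these choices never conflict. -/
theorem exists_represents (h : ∀ i j, inc j = some i → (pt i).submodule ≤ (line j).1) :
    ∃ c, Represents inc c pt line := by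
  have hline : ∀ j, ∃ a b, (line j).1 = Submodule.span ℂ {a, b} ∧
      ∀ i, inc j = some i → a = (pt i).rep := by
    intro j
    cases hj : inc j with
    | none =>
      obtain ⟨a, b, hab⟩ := exists_span_pair (line j).2
      exact ⟨a, b, hab, by simp⟩
    | some i =>
      obtain ⟨b, hb⟩ := exists_span_pair_eq (line j).2 (pt i).rep_nonzero
        (h i j hj (by rw [Projectivization.submodule_eq]; exact Submodule.mem_span_singleton_self _))
      exact ⟨_, b, hb, by simp⟩
  choose a b hab ha using hline
  refine ⟨Sum.elim (fun i => (pt i.1).rep i.2)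
    fun j => if j.2.1 = 0 then a j.1 j.2.2 else b j.1 j.2.2, fun i => ?_, fun j => ?_⟩
  · rw [Projectivization.submodule_eq]; rfl
  · rw [hab]
    congr 2
    unfold fstVec
    cases hj : inc j with
    | none => rfl
    | some i => rw [ha j i hj]; rfl

/-- Replace the unused coordinates by the coordinates of the points on the lines. -/
def adapt (inc : β → Option α) (c : ConfigIndex α β n → ℂ) : ConfigIndex α β n → ℂ
  | .inl e => c (.inl e)
  | .inr (j, r, k) => if r = 0 then fstVec inc c j k else c (.inr (j, r, k))

theorem isPolyFun_adapt (e : ConfigIndex α β n) : IsPolyFun fun c => adapt inc c e := by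
  rcases e with e | ⟨j, r, k⟩
  · exact .coord _
  · by_cases hr : r = 0
    · simp only [adapt, hr, if_true]
      exact isPolyFun_fstVec _ _
    · simp only [adapt, hr, if_false]
      exact .coord _

/-- The bridge between two kinds of coordinates: the topology is defined by two free vectors per
line, while the parametrization borrows the first vector from the point on the line. -/
theorem represents_none_adapt_iff :
    Represents (fun _ => none) (adapt inc c) pt line ↔ Represents inc c pt line :=
  Iff.rfl

/-- Replace the unused coordinates by those of `c₀`. -/
def fillUnused (inc : β → Option α) (c₀ c : ConfigIndex α β n → ℂ) : ConfigIndex α β n → ℂ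
  | .inl e => c (.inl e)
  | .inr (j, r, k) => if r = 0 ∧ (inc j).isSome then c₀ (.inr (j, r, k)) else c (.inr (j, r, k))

theorem isPolyFun_fillUnused (c₀ : ConfigIndex α β n → ℂ) (e : ConfigIndex α β n) :
    IsPolyFun fun c => fillUnused inc c₀ c e := by
  rcases e with e | ⟨j, r, k⟩
  · exact .coord _
  · by_cases hr : r = 0 ∧ (inc j).isSome
    · simp only [fillUnused, hr, and_self, if_true]
      exact .const _
    · simp only [fillUnused, if_neg hr]
      exact .coord _

theorem fillUnused_self : fillUnused inc c c = c := by
  funext e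
  rcases e with e | ⟨j, r, k⟩ <;> simp [fillUnused]

/-- `adapt` changes only coordinates that `fillUnused` overwrites. -/
theorem fillUnused_adapt (c₀ : ConfigIndex α β n → ℂ) :
    fillUnused inc c₀ (adapt inc c) = fillUnused inc c₀ c := by
  funext e
  rcases e with e | ⟨j, r, k⟩
  · rfl
  · by_cases hr : r = 0
    · subst hr
      cases hj : inc j <;> simp [fillUnused, hj, adapt, fstVec, lineVec]
    · simp [fillUnused, hr, adapt]

theorem fstVec_fillUnused (c₀ : ConfigIndex α β n → ℂ) (j : β) :
    fstVec inc (fillUnused inc c₀ c) j = fstVec inc c j := by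
  unfold fstVec
  cases hj : inc j with
  | none => funext k; simp [lineVec, fillUnused, hj]
  | some i => rfl

theorem represents_fillUnused_iff (c₀ : ConfigIndex α β n → ℂ) :
    Represents inc (fillUnused inc c₀ c) pt line ↔ Represents inc c pt line := by
  unfold Represents
  simp only [fstVec_fillUnused]
  exact Iff.rfl

theorem adapt_mem_nondegenerate (h : c ∈ nondegenerate inc n) :
    adapt inc c ∈ nondegenerate inc n := by
  refine ⟨h.1, fun j => ?_⟩
  have h1 : fstVec inc (adapt inc c) j = fstVec inc c j := by
    unfold fstVec
    cases hj : inc j with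
    | none => funext k; simp [lineVec, adapt, hj, fstVec]
    | some i => rfl
  rw [h1]
  exact h.2 j

/-- Coordinates of a configuration satisfying the incidences represent it also if the second
vector of each line is all that is used, besides the point on it. -/
theorem Represents.of_none (h : Represents (fun _ => none) c pt line)
    (hc : c ∈ nondegenerate inc n) (hinc : ∀ i j, inc j = some i → (pt i).submodule ≤ (line j).1) :
    Represents inc c pt line := by
  refine ⟨h.1, fun j => span_pair_eq_of_linearIndependent (line j).2
    (linearIndependent_of_mem_nondegenerate hc j) ?_ (h.lineVec_mem j)⟩
  cases hj : inc j with
  | none =>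
    simp only [fstVec, hj, Option.elim_none]
    exact h.fstVec_mem j
  | some i =>
    simp only [fstVec, hj, Option.elim_some]
    exact hinc i j hj (h.ptVec_mem i)

/-- Index set of the parameters of a change of coordinates: a scalar for each point, a matrix for
each line and arbitrary values for the unused coordinates. -/
abbrev RecoordIndex (α β : Type) (n : ℕ) : Type := α ⊕ (β × Fin 2 × Fin 2) ⊕ (β × Fin n)

/-- Change of coordinates with parameters `h`, applied to points `x` and pairs of vectors `z`. -/
def recoord (inc : β → Option α) (x : α → Fin n → ℂ) (z : β → Fin 2 → Fin n → ℂ)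
    (h : RecoordIndex α β n → ℂ) : ConfigIndex α β n → ℂ
  | .inl (i, k) => h (.inl i) * x i k
  | .inr (j, r, k) => if r = 0 ∧ (inc j).isSome then h (.inr (.inr (j, k))) else
      h (.inr (.inl (j, r, 0))) * z j 0 k + h (.inr (.inl (j, r, 1))) * z j 1 k

variable {x : α → Fin n → ℂ} {z : β → Fin 2 → Fin n → ℂ}

theorem isPolyFun_recoord {σ : Type} {x : (σ → ℂ) → α → Fin n → ℂ}
    {z : (σ → ℂ) → β → Fin 2 → Fin n → ℂ} {h : (σ → ℂ) → RecoordIndex α β n → ℂ}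
    (hx : ∀ i k, IsPolyFun fun s => x s i k) (hz : ∀ j r k, IsPolyFun fun s => z s j r k)
    (hh : ∀ e, IsPolyFun fun s => h s e) (e : ConfigIndex α β n) :
    IsPolyFun fun s => recoord inc (x s) (z s) (h s) e := by
  rcases e with ⟨i, k⟩ | ⟨j, r, k⟩
  · exact (hh _).mul (hx _ _)
  · by_cases hr : r = 0 ∧ (inc j).isSome
    · simp only [recoord, hr, and_self, if_true]
      exact hh _
    · simp only [recoord, if_neg hr]
      exact ((hh _).mul (hz _ _ _)).add ((hh _).mul (hz _ _ _))

/-- Two choices of spanning vectors differ by a scalar for each point and a matrix for each line;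
the unused coordinates are matched by the free parameters. So all coordinate vectors of one
configuration are reached by a polynomial family. -/
theorem Represents.exists_recoord_eq (h : Represents inc c pt line)
    (hx : ∀ i, (pt i).submodule = ℂ ∙ x i)
    (hz : ∀ j, (line j).1 = Submodule.span ℂ {z j 0, z j 1}) : ∃ g, recoord inc x z g = c := by
  have h1 : ∀ i, ∃ t : ℂ, t • x i = ptVec c i := fun i =>
    Submodule.mem_span_singleton.1 (hx i ▸ h.ptVec_mem i)
  have h2 : ∀ j (r : Fin 2), ∃ u : Fin 2 → ℂ, ¬ (r = 0 ∧ (inc j).isSome) →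
      u 0 • z j 0 + u 1 • z j 1 = lineVec c j r := by
    intro j r
    by_cases hr : r = 0 ∧ (inc j).isSome
    -- For a line with a point on it the first row of the matrix is never used, so any value serves.
    · exact ⟨0, fun h => absurd hr h⟩
    · have hmem : lineVec c j r ∈ (line j).1 := by
        fin_cases r
        · have hnone : inc j = none := by simpa using hr
          have := h.fstVec_mem j
          rw [fstVec, hnone] at this
          exact this
        · exact h.lineVec_mem j
      rw [hz j] at hmem
      obtain ⟨s, t, hst⟩ := Submodule.mem_span_pair.1 hmem
      exact ⟨![s, t], fun _ => by simpa using hst⟩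
  choose t ht using h1
  choose u hu using h2
  refine ⟨Sum.elim t (Sum.elim (fun e => u e.1 e.2.1 e.2.2) fun e => lineVec c e.1 0 e.2), ?_⟩
  funext e
  rcases e with ⟨i, k⟩ | ⟨j, r, k⟩
  · exact congrFun (ht i) k
  · by_cases hr : r = 0 ∧ (inc j).isSome
    · obtain ⟨rfl, hj⟩ := hr
      simp [recoord, hj, lineVec]
    · simp only [recoord, if_neg hr]
      exact congrFun (hu j r hr) k

/-- The new vectors lie in the old spans, and their independence forces equality by dimension. The
hypothesis on incidences covers lines whose first vector is that of a point. -/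
theorem Represents.of_recoord {g : RecoordIndex α β n → ℂ}
    (h : Represents inc (recoord inc x z g) pt line)
    (hinc : ∀ i j, inc j = some i → x i ∈ Submodule.span ℂ {z j 0, z j 1}) :
    (∀ i, (pt i).submodule = ℂ ∙ x i) ∧
      ∀ j, (line j).1 = Submodule.span ℂ {z j 0, z j 1} := by
  have hpt : ∀ i, ptVec (recoord inc x z g) i = g (.inl i) • x i := fun i => rfl
  constructor
  · intro i
    have hne := ptVec_ne_zero_of_mem_nondegenerate h.mem_nondegenerate i
    rw [hpt] at hne
    rw [h.1, hpt]
    exact Submodule.span_singleton_smul_eq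
      (isUnit_iff_ne_zero.2 fun h0 => hne (by rw [h0, zero_smul])) _
  · intro j
    have hli := linearIndependent_of_mem_nondegenerate h.mem_nondegenerate j
    have hrank := finrank_span_pair_eq_two_iff.2 hli
    have hvec : ∀ r, ¬ (r = 0 ∧ (inc j).isSome) →
        lineVec (recoord inc x z g) j r ∈ Submodule.span ℂ {z j 0, z j 1} := by
      intro r hr
      refine Submodule.mem_span_pair.2
        ⟨g (.inr (.inl (j, r, 0))), g (.inr (.inl (j, r, 1))), funext fun k => ?_⟩
      simp [lineVec, recoord, if_neg hr]
    have hle : Submodule.span ℂ {fstVec inc (recoord inc x z g) j, lineVec (recoord inc x z g) j 1} ≤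
        Submodule.span ℂ {z j 0, z j 1} := by
      refine Submodule.span_le.2 ?_
      rintro y (rfl | rfl)
      · cases hj : inc j with
        | none => simpa [fstVec, hj] using hvec 0 (by simp [hj])
        | some i =>
          simp only [fstVec, hj, Option.elim_some, hpt]
          exact Submodule.smul_mem _ _ (hinc i j hj)
      · exact hvec 1 (by simp)
    rw [h.2]
    refine Submodule.eq_of_le_of_finrank_le hle ?_
    rw [hrank]
    exact (finrank_span_le_card _).trans (by
      rw [Set.toFinset_card]
      exact (Fintype.card_le_of_surjective (fun r : Fin 2 => (⟨z j r, by fin_cases r <;> simp⟩ :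
        ({z j 0, z j 1} : Set (Fin n → ℂ)))) (by
          rintro ⟨y, rfl | rfl⟩
          exacts [⟨0, rfl⟩, ⟨1, rfl⟩])).trans (by simp))

theorem fstVec_add_smul (c c' : ConfigIndex α β n → ℂ) (t : ℂ) (j : β) :
    fstVec inc (c + t • c') j = fstVec inc c j + t • fstVec inc c' j := by
  unfold fstVec
  cases inc j <;> rfl

/-- This serves to prove openness in the quotient topology: for open `B` the left side is an open
condition on `c`, a union over `g` of polynomial preimages, while the right side depends only on the
configuration. -/
theorem Represents.exists_recoord_mem_iff {B : Set (ConfigIndex α β n → ℂ)}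
    (h : Represents (fun _ => none) c pt line) :
    (∃ g, recoord (fun _ => none) (ptVec c) (lineVec c) g ∈ B ∩ nondegenerate (fun _ => none) n) ↔
      ∃ b ∈ B, Represents (fun _ => none) b pt line := by
  constructor
  · rintro ⟨g, hgB, hg⟩
    obtain ⟨pt', line', h'⟩ := exists_represents_of_mem_nondegenerate hg
    have h1 := h'.of_recoord (by simp)
    obtain ⟨rfl, rfl⟩ := h.unique (c := c) (pt' := pt') (line' := line') ⟨h1.1, h1.2⟩
    exact ⟨_, hgB, h'⟩
  · rintro ⟨b, hb, h'⟩
    obtain ⟨g, rfl⟩ := h'.exists_recoord_eq (x := ptVec c) (z := lineVec c) h.1 h.2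
    exact ⟨g, hb, h'.mem_nondegenerate⟩

/-- The pencil spanned by the coordinates of two configurations consists, up to finitely many
exceptions, of coordinates of configurations. -/
theorem Represents.finite_setOf_degenerate [Finite α] [Finite β] (h : Represents inc c pt line)
    (c' : ConfigIndex α β n → ℂ) : {t : ℂ | c + t • c' ∉ nondegenerate inc n}.Finite := by
  have h1 := Set.finite_iUnion fun i => finite_setOf_add_smul_eq_zero
    (ptVec_ne_zero_of_mem_nondegenerate h.mem_nondegenerate i) (ptVec c' i)
  have h2 := Set.finite_iUnion fun j => finite_setOf_not_linearIndependent
    (linearIndependent_of_mem_nondegenerate h.mem_nondegenerate j) (fstVec inc c' j)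
      (lineVec c' j 1)
  refine (h1.union h2).subset fun t ht => ?_
  by_contra hn
  simp only [Set.mem_union, Set.mem_iUnion, not_or, not_exists] at hn
  refine ht ⟨fun i => Function.ne_iff.1 (hn.1 i), fun j => ?_⟩
  have h3 := linearIndependent_pair_iff_minor.1 (not_not.1 (hn.2 j))
  rw [fstVec_add_smul]
  exact h3

/-- Distinct members of the pencil of two distinct configurations are distinct. -/
theorem Represents.pencil_injective {c' : ConfigIndex α β n → ℂ} (h : Represents inc c pt line)
    (h' : Represents inc c' pt' line') {pt'' : α → ProjPoint n} {line'' : β → ProjLine n}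
    {t u : ℂ} (htu : t ≠ u) (ht : Represents inc (c + t • c') pt'' line'')
    (hu : Represents inc (c + u • c') pt'' line'') : pt = pt' ∧ line = line' := by
  -- Two distinct members of a pencil of vectors span all of it.
  have key : ∀ (W : Submodule ℂ (Fin n → ℂ)) (a b : Fin n → ℂ), a + t • b ∈ W → a + u • b ∈ W →
      a ∈ W ∧ b ∈ W := by
    intro W a b h1 h2
    have hb : b ∈ W := by
      have h3 := W.sub_mem h1 h2
      rw [add_sub_add_left_eq_sub, ← sub_smul] at h3
      exact (W.smul_mem_iff (sub_ne_zero.2 htu)).1 h3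
    exact ⟨(W.add_mem_iff_left (W.smul_mem t hb)).1 h1, hb⟩
  constructor
  · funext i
    obtain ⟨h1, h2⟩ := key _ (ptVec c i) (ptVec c' i) (ht.ptVec_mem i) (hu.ptVec_mem i)
    refine Projectivization.submodule_injective ?_
    rw [h.1, h'.1, ← ProjPoint.submodule_eq_span
      (ptVec_ne_zero_of_mem_nondegenerate h.mem_nondegenerate i) h1,
      ← ProjPoint.submodule_eq_span
      (ptVec_ne_zero_of_mem_nondegenerate h'.mem_nondegenerate i) h2]
  · funext j
    obtain ⟨h1, h2⟩ := key _ (lineVec c j 1) (lineVec c' j 1) (ht.lineVec_mem j) (hu.lineVec_mem j)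
    obtain ⟨h3, h4⟩ := key _ (fstVec inc c j) (fstVec inc c' j)
      (by rw [← fstVec_add_smul]; exact ht.fstVec_mem j)
      (by rw [← fstVec_add_smul]; exact hu.fstVec_mem j)
    refine Subtype.ext ?_
    rw [h.2, h'.2, ← span_pair_eq_of_linearIndependent (line'' j).2
      (linearIndependent_of_mem_nondegenerate h.mem_nondegenerate j) h3 h1,
      ← span_pair_eq_of_linearIndependent (line'' j).2
      (linearIndependent_of_mem_nondegenerate h'.mem_nondegenerate j) h4 h2]

end Config

/-! ### Quaternions and rotations -/

/-- The square norm of a complex quaternion. -/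
def quatNorm (q : Fin 4 → ℂ) : ℂ := q 0 ^ 2 + q 1 ^ 2 + q 2 ^ 2 + q 3 ^ 2

/-- The square norm of `q` times the rotation given by `q`. -/
def quatMat (q : Fin 4 → ℂ) : Matrix (Fin 3) (Fin 3) ℂ :=
  !![q 0 ^ 2 + q 1 ^ 2 - q 2 ^ 2 - q 3 ^ 2, 2 * (q 1 * q 2 - q 0 * q 3),
      2 * (q 1 * q 3 + q 0 * q 2);
    2 * (q 1 * q 2 + q 0 * q 3), q 0 ^ 2 - q 1 ^ 2 + q 2 ^ 2 - q 3 ^ 2,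
      2 * (q 2 * q 3 - q 0 * q 1);
    2 * (q 1 * q 3 - q 0 * q 2), 2 * (q 2 * q 3 + q 0 * q 1),
      q 0 ^ 2 - q 1 ^ 2 - q 2 ^ 2 + q 3 ^ 2]

theorem transpose_quatMat_mul_self (q : Fin 4 → ℂ) :
    (quatMat q).transpose * quatMat q = quatNorm q ^ 2 • (1 : Matrix (Fin 3) (Fin 3) ℂ) := by
  ext i j
  fin_cases i <;> fin_cases j <;>
    simp [quatMat, quatNorm, Matrix.mul_apply, Fin.sum_univ_three] <;> ring

theorem det_quatMat (q : Fin 4 → ℂ) : (quatMat q).det = quatNorm q ^ 3 := by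
  rw [Matrix.det_fin_three]
  simp [quatMat, quatNorm]
  ring

theorem inv_quatNorm_smul_quatMat {q : Fin 4 → ℂ} (hq : quatNorm q ≠ 0) :
    ((quatNorm q)⁻¹ • quatMat q).transpose * ((quatNorm q)⁻¹ • quatMat q) = 1 ∧
      ((quatNorm q)⁻¹ • quatMat q).det = 1 := by
  constructor
  · rw [Matrix.transpose_smul, Matrix.smul_mul, Matrix.mul_smul, transpose_quatMat_mul_self,
      smul_smul, smul_smul]
    have : (quatNorm q)⁻¹ * (quatNorm q)⁻¹ * quatNorm q ^ 2 = 1 := by field_simp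
    rw [this, one_smul]
  · rw [Matrix.det_smul, det_quatMat, Fintype.card_fin, ← mul_pow, inv_mul_cancel₀ hq, one_pow]

/-- If `R` is the rotation of a unit quaternion `q`, the entries of `4 q qᵀ` are affine linear in
those of `R`. The four vectors tried below are the rows of this matrix: each has square norm four
times its diagonal entry, and the diagonal entries add up to 4, so one row has nonzero norm. -/
theorem exists_quatMat_eq_smul {R : Matrix (Fin 3) (Fin 3) ℂ} (h : R.transpose * R = 1)
    (hd : R.det = 1) : ∃ q, quatNorm q ≠ 0 ∧ quatMat q = quatNorm q • R := by
  -- For determinant one, orthogonality says that each entry equals its cofactor. These relations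
  -- exclude reflections.
  have hadj : R.adjugate = R.transpose := by
    have h1 : R * R.adjugate = 1 := by rw [Matrix.mul_adjugate, hd, one_smul]
    rw [← Matrix.one_mul R.adjugate, ← h, Matrix.mul_assoc, h1, Matrix.mul_one]
  have h' : R * R.transpose = 1 := mul_eq_one_comm.1 h
  obtain ⟨a, b, c, d, e, f, g, k, i, rfl⟩ : ∃ a b c d e f g k i, R = !![a, b, c; d, e, f; g, k, i] :=
    ⟨_, _, _, _, _, _, _, _, _, Matrix.eta_fin_three R⟩
  rw [Matrix.adjugate_fin_three_of] at hadj
  have col := fun i j => congrFun (congrFun h i) j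
  have row := fun i j => congrFun (congrFun h' i) j
  have cof := fun i j => congrFun (congrFun hadj i) j
  simp only [Fin.forall_fin_succ, Matrix.mul_apply, Fin.sum_univ_three] at col row cof
  simp at col row cof
  obtain ⟨⟨l1, l2, l3⟩, ⟨-, l4, l5⟩, -, -, l6⟩ := col
  obtain ⟨⟨r1, r2, r3⟩, ⟨-, r4, r5⟩, -, -, r6⟩ := row
  obtain ⟨⟨c1, c2, c3⟩, ⟨c4, c5, c6⟩, c7, c8, c9⟩ := cof
  have key : ∀ q : Fin 4 → ℂ, ∀ s ≠ 0, quatNorm q = 4 * s →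
      quatMat q = quatNorm q • !![a, b, c; d, e, f; g, k, i] →
      ∃ q, quatNorm q ≠ 0 ∧ quatMat q = quatNorm q • !![a, b, c; d, e, f; g, k, i] :=
    fun q s hs hq h => ⟨q, by rw [hq]; exact mul_ne_zero (by norm_num) hs, h⟩
  have hsum : 1 + a + e + i ≠ 0 ∨ 1 + a - e - i ≠ 0 ∨ 1 - a + e - i ≠ 0 ∨ 1 - a - e + i ≠ 0 := by
    by_contra! h0
    obtain ⟨h1, h2, h3, h4⟩ := h0
    exact (by norm_num : (4 : ℂ) ≠ 0) (by linear_combination h1 + h2 + h3 + h4)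
  rcases hsum with hs | hs | hs | hs
  · have hn : quatNorm ![1 + a + e + i, k - f, c - g, d - b] = 4 * (1 + a + e + i) := by
      simp [quatNorm]; grind
    refine key _ _ hs hn ?_
    rw [hn]
    ext x y
    fin_cases x <;> fin_cases y <;> simp [quatMat] <;> grind
  · have hn : quatNorm ![k - f, 1 + a - e - i, b + d, c + g] = 4 * (1 + a - e - i) := by
      simp [quatNorm]; grind
    refine key _ _ hs hn ?_
    rw [hn]
    ext x y
    fin_cases x <;> fin_cases y <;> simp [quatMat] <;> grind
  · have hn : quatNorm ![c - g, b + d, 1 - a + e - i, f + k] = 4 * (1 - a + e - i) := by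
      simp [quatNorm]; grind
    refine key _ _ hs hn ?_
    rw [hn]
    ext x y
    fin_cases x <;> fin_cases y <;> simp [quatMat] <;> grind
  · have hn : quatNorm ![d - b, c + g, f + k, 1 - a - e + i] = 4 * (1 - a - e + i) := by
      simp [quatNorm]; grind
    refine key _ _ hs hn ?_
    rw [hn]
    ext x y
    fin_cases x <;> fin_cases y <;> simp [quatMat] <;> grind

/-! ### Rational functions and the Zariski topology -/

/-- `F` is a quotient of polynomial functions on `O`. -/
def RatOn {σ : Type} (O : Set (σ → ℂ)) (F : (σ → ℂ) → ℂ) : Prop :=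
  ∃ G D, IsPolyFun G ∧ IsPolyFun D ∧ ∀ s ∈ O, D s ≠ 0 ∧ F s = G s / D s

namespace RatOn

variable {σ τ : Type} {O : Set (σ → ℂ)} {F F' : (σ → ℂ) → ℂ}

theorem div (hF : IsPolyFun F) (hF' : IsPolyFun F') (h : ∀ s ∈ O, F' s ≠ 0) :
    RatOn O fun s => F s / F' s :=
  ⟨F, F', hF, hF', fun s hs => ⟨h s hs, rfl⟩⟩

theorem of_isPolyFun (hF : IsPolyFun F) : RatOn O F :=
  ⟨F, fun _ => 1, hF, .const 1, fun _ _ => ⟨one_ne_zero, (div_one _).symm⟩⟩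

theorem add (h : RatOn O F) (h' : RatOn O F') : RatOn O fun s => F s + F' s := by
  obtain ⟨G, D, hG, hD, hF⟩ := h
  obtain ⟨G', D', hG', hD', hF'⟩ := h'
  refine ⟨_, _, (hG.mul hD').add (hD.mul hG'), hD.mul hD', fun s hs => ?_⟩
  refine ⟨mul_ne_zero (hF s hs).1 (hF' s hs).1, ?_⟩
  change F s + F' s = _
  rw [(hF s hs).2, (hF' s hs).2, div_add_div _ _ (hF s hs).1 (hF' s hs).1]

theorem mul (h : RatOn O F) (h' : RatOn O F') : RatOn O fun s => F s * F' s := by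
  obtain ⟨G, D, hG, hD, hF⟩ := h
  obtain ⟨G', D', hG', hD', hF'⟩ := h'
  refine ⟨_, _, hG.mul hG', hD.mul hD', fun s hs => ?_⟩
  refine ⟨mul_ne_zero (hF s hs).1 (hF' s hs).1, ?_⟩
  change F s * F' s = _
  rw [(hF s hs).2, (hF' s hs).2, div_mul_div_comm]

theorem comp {F : (τ → ℂ) → ℂ} (hF : IsPolyFun F) {r : (σ → ℂ) → τ → ℂ}
    (hr : ∀ e, RatOn O fun s => r s e) : RatOn O fun s => F (r s) := by
  obtain ⟨p, hp⟩ := hF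
  simp only [hp]
  clear hp
  induction p using MvPolynomial.induction_on with
  | C a => simpa using of_isPolyFun (.const a)
  | add p q hp hq => simpa only [map_add] using hp.add hq
  | mul_X p e hp => simpa only [map_mul, eval_X] using hp.mul (hr e)

end RatOn

theorem isOpen_zariskiAffine_iff {σ : Type} {O : Set (σ → ℂ)} :
    IsOpen[zariskiAffine σ] O ↔ ZOpen O := by
  constructor
  · intro h
    induction h with
    | basic s hs =>
      obtain ⟨f, rfl⟩ := hs
      exact .ne_zero (.of_eval f)
    | univ => exact .univ
    | inter s t _ _ hs ht => exact hs.inter ht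
    | sUnion S _ ih =>
      rintro x ⟨s, hs, hx⟩
      obtain ⟨F, hF, hFx, h⟩ := ih s hs x hx
      exact ⟨F, hF, hFx, fun y hy => ⟨s, hs, h y hy⟩⟩
  · intro h
    have hO : O = ⋃₀ {B | (∃ f : MvPolynomial σ ℂ, B = {x | eval x f ≠ 0}) ∧ B ⊆ O} := by
      ext x
      constructor
      · intro hx
        obtain ⟨F, ⟨p, hp⟩, hFx, hF⟩ := h x hx
        refine ⟨{x | eval x p ≠ 0}, ⟨⟨p, rfl⟩, fun y hy => hF y ?_⟩, ?_⟩
        · rw [hp]; exact hy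
        · change eval x p ≠ 0
          rwa [← hp]
      · rintro ⟨B, ⟨-, hB⟩, hx⟩
        exact hB hx
    rw [hO]
    refine @isOpen_sUnion _ (zariskiAffine σ) _ ?_
    rintro B ⟨⟨f, rfl⟩, -⟩
    exact TopologicalSpace.isOpen_generateFrom_of_mem ⟨f, rfl⟩

theorem isOpen_zariskiQuotient_iff {σ T : Type} {A : Set (σ → ℂ)} {q : A → T} {U : Set T} :
    IsOpen[zariskiQuotient A q] U ↔ ∃ O, ZOpen O ∧ ∀ b : A, b.1 ∈ O ↔ q b ∈ U := by
  let _ := zariskiAffine σ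
  have h1 : IsOpen[zariskiQuotient A q] U ↔ IsOpen (q ⁻¹' U) := Iff.rfl
  rw [h1, isOpen_induced_iff]
  constructor
  · rintro ⟨O, hO, hOU⟩
    exact ⟨O, isOpen_zariskiAffine_iff.1 hO, fun b => Set.ext_iff.1 hOU b⟩
  · rintro ⟨O, hO, hOU⟩
    exact ⟨O, isOpen_zariskiAffine_iff.2 hO, Set.ext hOU⟩

/-! ### Functional relations -/

open Classical in
/-- The element related to `b`, if there is one. -/
noncomputable def relatedTo {α β : Type} (r : α → β → Prop) (b : β) : Option α :=
  if h : ∃ a, r a b then some h.choose else none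

theorem relatedTo_eq_some_iff {α β : Type} {r : α → β → Prop}
    (hr : ∀ b a a', r a b → r a' b → a = a') {a : α} {b : β} :
    relatedTo r b = some a ↔ r a b := by
  unfold relatedTo
  split_ifs with h
  · rw [Option.some_inj]
    exact ⟨fun h' => h' ▸ h.choose_spec, fun h' => hr _ _ _ h.choose_spec h'⟩
  · simp only [false_iff]
    exact fun h' => h ⟨a, h'⟩

namespace PointLineProblem

variable {m : ℕ} (P : PointLineProblem m)

/-- The point on a line, if there is one. -/
noncomputable def lineInc : Fin P.l → Option (Fin P.p) := relatedTo P.inc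

/-- The observed point on an observed line, if there is one. -/
noncomputable def imageInc : (Σ v, P.obsLine v) → Option (Σ v, P.obsPt v) :=
  relatedTo fun w u => w.1 = u.1 ∧ P.inc w.2 u.2

variable {P}

theorem lineInc_eq_some_iff (hP : P.IsPL1P) {i : Fin P.p} {j : Fin P.l} :
    P.lineInc j = some i ↔ P.inc i j :=
  relatedTo_eq_some_iff fun j i i' h h' => hP j i i' h h'

theorem imageInc_eq_some_iff (hP : P.IsPL1P) {w : Σ v, P.obsPt v} {u : Σ v, P.obsLine v} :
    P.imageInc u = some w ↔ w.1 = u.1 ∧ P.inc w.2 u.2 := by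
  refine relatedTo_eq_some_iff
    (r := fun (w : Σ v, P.obsPt v) (u : Σ v, P.obsLine v) => w.1 = u.1 ∧ P.inc w.2 u.2) ?_
  rintro ⟨v, j⟩ ⟨v1, i1⟩ ⟨v2, i2⟩ ⟨h1, h1'⟩ ⟨h2, h2'⟩
  obtain rfl : v1 = v := h1
  obtain rfl : v2 = v1 := h2
  exact congrArg _ (Subtype.ext (hP _ _ _ h1' h2'))

/-! ### Coordinates of joint images -/

/-- `c` represents the joint image `y`. -/
def ImageRep (c : P.ImageIndex → ℂ) (y : P.Image) : Prop :=
  Represents P.imageInc c (fun w => y.pt w.1 w.2) fun u => y.line u.1 u.2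

theorem image_eq_of_represents {inc : (Σ v, P.obsLine v) → Option (Σ v, P.obsPt v)}
    {c : P.ImageIndex → ℂ} {y y' : P.Image}
    (h : Represents inc c (fun w => y.pt w.1 w.2) fun u => y.line u.1 u.2)
    (h' : Represents inc c (fun w => y'.pt w.1 w.2) fun u => y'.line u.1 u.2) : y = y' := by
  obtain ⟨h1, h2⟩ := Represents.unique h h'
  cases y
  cases y'
  congr
  · funext v i
    exact congrFun h1 ⟨v, i⟩
  · funext v j
    exact congrFun h2 ⟨v, j⟩

theorem ImageRep.unique {c : P.ImageIndex → ℂ} {y y' : P.Image} (h : ImageRep c y)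
    (h' : ImageRep c y') : y = y' :=
  image_eq_of_represents h h'

theorem exists_imageRep_of_mem_nondegenerate {c : P.ImageIndex → ℂ}
    (hc : c ∈ nondegenerate P.imageInc 3) : ∃ y, ImageRep c y := by
  obtain ⟨pt, line, h⟩ := exists_represents_of_mem_nondegenerate hc
  exact ⟨⟨fun v i => pt ⟨v, i⟩, fun v j => line ⟨v, j⟩⟩, h⟩

/-- Adapted coordinates build in the incidence of a line with the observed point on it, and in a
PL1P there is no second one. Hence no equations between coordinates remain. -/
theorem exists_imageRep_iff (hP : P.IsPL1P) {y : P.Image} :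
    (∃ c, ImageRep c y) ↔ y ∈ P.imageVariety := by
  constructor
  · rintro ⟨c, hc⟩ v i j hij
    exact hc.incident (i := ⟨v, i⟩) (j := ⟨v, j⟩) ((imageInc_eq_some_iff hP).2 ⟨rfl, hij⟩)
  · intro hy
    refine exists_represents fun w u h => ?_
    obtain ⟨v, i⟩ := w
    obtain ⟨v', j⟩ := u
    obtain ⟨hv, hij⟩ := (imageInc_eq_some_iff hP).1 h
    obtain rfl : v = v' := hv
    exact hy v i j hij

/-- Without built-in incidences, `Represents` is the graph of the quotient map that defines the
topology on joint images. -/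
theorem represents_none_iff {b : P.ImageIndex → ℂ} {y : P.Image} :
    Represents (fun _ => none) b (fun w => y.pt w.1 w.2) (fun u => y.line u.1 u.2) ↔
      ∃ h : b ∈ P.imageCoords, P.imageOfCoords ⟨b, h⟩ = y := by
  have hvec : ∀ j, (fun (r : Fin 2) (k : Fin 3) => b (.inr (j, r, k))) =
      ![fstVec (fun _ => (none : Option (Σ v, P.obsPt v))) b j, lineVec b j 1] := by
    intro j
    funext r
    fin_cases r <;> rfl
  have hq : ∀ h : b ∈ P.imageCoords,
      Represents (fun _ => none) b (fun w => (P.imageOfCoords ⟨b, h⟩).pt w.1 w.2)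
        fun u => (P.imageOfCoords ⟨b, h⟩).line u.1 u.2 := by
    refine fun h => ⟨fun i => Projectivization.submodule_mk _ _, fun j => ?_⟩
    change Submodule.span ℂ (Set.range fun (r : Fin 2) (k : Fin 3) => b (.inr (j, r, k))) = _
    rw [hvec, Matrix.range_cons, Matrix.range_cons, Matrix.range_empty, Set.union_empty,
      Set.singleton_union]
  constructor
  · intro h
    have hmem : b ∈ P.imageCoords := by
      refine ⟨fun i => ptVec_ne_zero_of_mem_nondegenerate h.mem_nondegenerate i, fun j => ?_⟩
      rw [hvec]
      exact linearIndependent_of_mem_nondegenerate h.mem_nondegenerate j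
    exact ⟨hmem, image_eq_of_represents (hq hmem) h⟩
  · rintro ⟨h, rfl⟩
    exact hq h

/-- The members of an open set of joint images are represented by an open set of coordinates. -/
theorem ImageRep.exists_open {U : Set P.Image} (hU : IsOpen U) {c : P.ImageIndex → ℂ} {y : P.Image}
    (hc : ImageRep c y) (hy : y ∈ U) :
    ∃ O : Set (P.ImageIndex → ℂ), ZOpen O ∧ c ∈ O ∧ ∀ c' ∈ O, ∃ y' ∈ U, ImageRep c' y' := by
  obtain ⟨O, hO, hOU⟩ := isOpen_zariskiQuotient_iff.1 hU
  refine ⟨adapt P.imageInc ⁻¹' O ∩ nondegenerate P.imageInc 3,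
    (hO.preimage isPolyFun_adapt).inter zOpen_nondegenerate, ⟨?_, hc.mem_nondegenerate⟩,
    fun c' hc' => ?_⟩
  · obtain ⟨h, hy'⟩ := represents_none_iff.1 (represents_none_adapt_iff.2 hc)
    exact (hOU ⟨_, h⟩).2 (hy' ▸ hy)
  · obtain ⟨y', hy'⟩ := exists_imageRep_of_mem_nondegenerate hc'.2
    obtain ⟨h, rfl⟩ := represents_none_iff.1 (represents_none_adapt_iff.2 hy')
    exact ⟨_, (hOU ⟨_, h⟩).1 hc'.1, hy'⟩

end PointLineProblem

theorem camRot_smul (t : ℂ) (A : Matrix (Fin 3) (Fin 4) ℂ) : camRot (t • A) = t • camRot A := rfl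

theorem camTrans_smul (t : ℂ) (A : Matrix (Fin 3) (Fin 4) ℂ) : camTrans (t • A) = t • camTrans A :=
  rfl

theorem cam_ext {A B : Matrix (Fin 3) (Fin 4) ℂ} (h : camRot A = camRot B)
    (h' : camTrans A = camTrans B) : A = B := by
  ext a k
  refine Fin.lastCases ?_ (fun k => ?_) k
  · exact congrFun h' a
  · exact congrFun (congrFun h a) k

namespace PointLineProblem

variable {m : ℕ} {P : PointLineProblem m}

/-- The image variety is parametrized by an affine space. -/
theorem generically_imageVariety_iff (hP : P.IsPL1P) {Q : P.Image → Prop} :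
    Generically P.imageVariety Q ↔
      ∃ O : Set (P.ImageIndex → ℂ), ZOpen O ∧ O.Nonempty ∧ ∀ c ∈ O, ∀ y, ImageRep c y → Q y := by
  constructor
  · rintro ⟨U, hU, hdense, hQ⟩
    obtain ⟨c0, hc0⟩ := nondegenerate_nonempty (n := 3) (by norm_num) P.imageInc
    obtain ⟨y0, hy0⟩ := exists_imageRep_of_mem_nondegenerate hc0
    have hne : (P.imageVariety ∩ U).Nonempty :=
      closure_nonempty_iff.1 ⟨y0, hdense ((exists_imageRep_iff hP).1 ⟨c0, hy0⟩)⟩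
    obtain ⟨y1, hy1, hy1U⟩ := hne
    obtain ⟨c1, hc1⟩ := (exists_imageRep_iff hP).2 hy1
    obtain ⟨O, hO, hcO, hOU⟩ := hc1.exists_open hU hy1U
    refine ⟨O, hO, ⟨c1, hcO⟩, fun c hc y hy => ?_⟩
    obtain ⟨y', hy'U, hy'⟩ := hOU c hc
    obtain rfl := hy.unique hy'
    exact hQ _ ⟨(exists_imageRep_iff hP).1 ⟨c, hy⟩, hy'U⟩
  · rintro ⟨O, hO, ⟨c0, hc0⟩, hQ⟩
    -- `O` may constrain the unused coordinates, which a joint image does not determine. Freezing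
    -- them at those of `c0` removes the constraint and keeps `c0` in the preimage.
    let B : Set (P.ImageIndex → ℂ) := fillUnused P.imageInc c0 ⁻¹' O ∩ nondegenerate P.imageInc 3
    have hB : ZOpen B := (hO.preimage (isPolyFun_fillUnused c0)).inter zOpen_nondegenerate
    let U : Set P.Image := {y | ∃ b ∈ B, Represents (fun _ => none) b (fun w => y.pt w.1 w.2)
      fun u => y.line u.1 u.2}
    have hU : IsOpen U := by
      refine isOpen_zariskiQuotient_iff.2 ⟨⋃ g, (fun b => recoord (fun _ => none) (ptVec b)
        (lineVec b) g) ⁻¹' (B ∩ nondegenerate (fun _ => none) 3), .iUnion fun g =>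
        (hB.inter zOpen_nondegenerate).preimage (isPolyFun_recoord (fun _ _ => .coord _)
          (fun _ _ _ => .coord _) fun _ => .const _), ?_⟩
      rintro ⟨b, hb⟩
      have hrep := represents_none_iff.2 ⟨hb, rfl⟩
      rw [Set.mem_iUnion]
      exact hrep.exists_recoord_mem_iff
    have hinc : ∀ y ∈ P.imageVariety, ∀ w u, P.imageInc u = some w →
        (y.pt w.1 w.2).submodule ≤ (y.line u.1 u.2).1 := by
      intro y hy w u hwu
      obtain ⟨c, hc⟩ := (exists_imageRep_iff hP).2 hy
      exact hc.incident hwu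
    refine ⟨U, hU, fun y hy => ?_, ?_⟩
    · refine mem_closure_iff.2 fun W hW hyW => ?_
      obtain ⟨c, hc⟩ := (exists_imageRep_iff hP).2 hy
      obtain ⟨O1, hO1, hcO1, hO1W⟩ := hc.exists_open hW hyW
      have hB' : B.Nonempty := by
        refine (hO.preimage (isPolyFun_fillUnused c0)).inter_nonempty zOpen_nondegenerate ⟨c0, ?_⟩
          ⟨c, hc.mem_nondegenerate⟩
        rw [Set.mem_preimage, fillUnused_self]
        exact hc0
      -- Density comes from the irreducibility of the coordinate space: every nonempty open set in
      -- it meets `B`.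
      obtain ⟨c2, hc2O, hc2B⟩ := hO1.inter_nonempty hB ⟨c, hcO1⟩ hB'
      obtain ⟨y2, hy2W, hy2⟩ := hO1W c2 hc2O
      refine ⟨y2, hy2W, (exists_imageRep_iff hP).1 ⟨c2, hy2⟩, adapt P.imageInc c2, ⟨?_, ?_⟩,
        represents_none_adapt_iff.2 hy2⟩
      · rw [Set.mem_preimage, fillUnused_adapt]
        exact hc2B.1
      · exact adapt_mem_nondegenerate hc2B.2
    · rintro y ⟨hy, b, hb, h⟩
      exact hQ _ hb.1 y ((represents_fillUnused_iff c0).2 (h.of_none hb.2 fun i j hij =>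
        hinc y hy i j hij))

/-! ### Parameters for arrangements and cameras -/

/-- Index set of the parameters of an arrangement with cameras: coordinates of the points and
lines, a quaternion and a translation vector for each camera. -/
abbrev ParamIndex (P : PointLineProblem m) : Type :=
  ConfigIndex (Fin P.p) (Fin P.l) 4 ⊕ (Fin m × (Fin 4 ⊕ Fin 3))

/-- The coordinates of the points and lines. -/
def configPart (s : P.ParamIndex → ℂ) : ConfigIndex (Fin P.p) (Fin P.l) 4 → ℂ := fun e => s (.inl e)

/-- The quaternion of a camera. -/
def quatPart (s : P.ParamIndex → ℂ) (v : Fin m) : Fin 4 → ℂ := fun k => s (.inr (v, .inl k))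

/-- The translation vector of a camera. -/
def transPart (s : P.ParamIndex → ℂ) (v : Fin m) : Fin 3 → ℂ := fun k => s (.inr (v, .inr k))

/-- The norm of the quaternion of a camera. -/
def normPart (s : P.ParamIndex → ℂ) (v : Fin m) : ℂ := quatNorm (quatPart s v)

/-- The left block of a camera matrix, times the norm of the quaternion. -/
def scaledRot (s : P.ParamIndex → ℂ) (v : Fin m) : Matrix (Fin 3) (Fin 3) ℂ :=
  if v.val = 0 then normPart s v • 1 else quatMat (quatPart s v)

/-- The last column of a camera matrix, times the norm of the quaternion. -/
def scaledTrans (s : P.ParamIndex → ℂ) (v : Fin m) (a : Fin 3) : ℂ :=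
  if v.val = 0 then 0 else
    if v.val = 1 ∧ a = 0 then normPart s v else normPart s v * transPart s v a

/-- A camera matrix, times the norm of the quaternion. -/
def scaledCam (s : P.ParamIndex → ℂ) (v : Fin m) : Matrix (Fin 3) (Fin 4) ℂ :=
  Matrix.of fun a k => Fin.lastCases (scaledTrans s v a) (scaledRot s v a) k

/-- The parameters `s` describe the arrangement with cameras `S`. -/
def WorldRep (s : P.ParamIndex → ℂ) (S : World P.p P.l m) : Prop :=
  Represents P.lineInc (configPart s) S.pt S.line ∧ (∀ v, normPart s v ≠ 0) ∧
    ∀ v, scaledCam s v = normPart s v • S.cam v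

/-- The parameters that describe an arrangement with cameras. -/
def admissible (P : PointLineProblem m) : Set (P.ParamIndex → ℂ) :=
  {s | configPart s ∈ nondegenerate P.lineInc 4 ∧ ∀ v, normPart s v ≠ 0}

theorem WorldRep.mem_admissible {s : P.ParamIndex → ℂ} {S : World P.p P.l m} (h : WorldRep s S) :
    s ∈ P.admissible :=
  ⟨h.1.mem_nondegenerate, h.2.1⟩

theorem exists_worldRep_of_mem_admissible {s : P.ParamIndex → ℂ} (hs : s ∈ P.admissible) :
    ∃ S, WorldRep s S := by
  obtain ⟨pt, line, h⟩ := exists_represents_of_mem_nondegenerate hs.1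
  refine ⟨⟨pt, line, fun v => (normPart s v)⁻¹ • scaledCam s v⟩, h, hs.2, fun v => ?_⟩
  simp only
  rw [smul_smul, mul_inv_cancel₀ (hs.2 v), one_smul]

theorem camRot_scaledCam (s : P.ParamIndex → ℂ) (v : Fin m) :
    camRot (scaledCam s v) = scaledRot s v := by
  ext a k
  simp [camRot, scaledCam]

theorem camTrans_scaledCam (s : P.ParamIndex → ℂ) (v : Fin m) :
    camTrans (scaledCam s v) = scaledTrans s v := by
  ext a
  simp only [camTrans, scaledCam, Matrix.of_apply, Fin.lastCases_last]

theorem WorldRep.camRot_eq {s : P.ParamIndex → ℂ} {S : World P.p P.l m} (h : WorldRep s S)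
    (v : Fin m) : camRot (S.cam v) = (normPart s v)⁻¹ • scaledRot s v := by
  rw [← camRot_scaledCam, h.2.2]
  rw [camRot_smul, smul_smul, inv_mul_cancel₀ (h.2.1 v), one_smul]

theorem WorldRep.camTrans_eq {s : P.ParamIndex → ℂ} {S : World P.p P.l m} (h : WorldRep s S)
    (v : Fin m) : camTrans (S.cam v) = (normPart s v)⁻¹ • scaledTrans s v := by
  rw [← camTrans_scaledCam, h.2.2]
  rw [camTrans_smul, smul_smul, inv_mul_cancel₀ (h.2.1 v), one_smul]

/-- The domain of the joint camera map is parametrized by an open subset of an affine space. -/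
theorem exists_worldRep_iff (hP : P.IsPL1P) {S : World P.p P.l m} :
    (∃ s, WorldRep s S) ↔ S ∈ P.domain := by
  constructor
  · rintro ⟨s, h⟩
    refine ⟨fun i j hij => h.1.incident ((lineInc_eq_some_iff hP).2 hij), fun v => ?_,
      fun v hv => ?_, fun v hv => ?_⟩
    · rw [h.camRot_eq]
      by_cases hv : v.val = 0
      · simp only [scaledRot, hv, if_true]
        rw [smul_smul, inv_mul_cancel₀ (h.2.1 v), one_smul]
        simp
      · simp only [scaledRot, hv, if_false]
        exact inv_quatNorm_smul_quatMat (h.2.1 v)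
    · rw [h.camRot_eq, h.camTrans_eq]
      constructor
      · simp only [scaledRot, hv, if_true]
        rw [smul_smul, inv_mul_cancel₀ (h.2.1 v), one_smul]
      · funext a
        simp [scaledTrans, hv]
    · rw [h.camTrans_eq]
      simp [scaledTrans, hv, h.2.1 v]
  · rintro ⟨hinc, hrot, h0, h1⟩
    obtain ⟨c, hc⟩ := exists_represents (inc := P.lineInc) (pt := S.pt) (line := S.line)
      fun i j hij => hinc i j ((lineInc_eq_some_iff hP).1 hij)
    -- The first camera receives a quaternion too, but only the nonvanishing of its norm matters
    -- there.
    choose q hq hqR using fun v => exists_quatMat_eq_smul (hrot v).1 (hrot v).2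
    obtain ⟨s, hs, hsq, hst⟩ : ∃ s : P.ParamIndex → ℂ, configPart s = c ∧
        (∀ v, quatPart s v = q v) ∧ ∀ v, transPart s v = camTrans (S.cam v) :=
      ⟨Sum.elim c fun e => Sum.elim (q e.1) (camTrans (S.cam e.1)) e.2, rfl, fun _ => rfl,
        fun _ => rfl⟩
    have hn : ∀ v, normPart s v = quatNorm (q v) := fun v => by rw [normPart, hsq]
    refine ⟨s, by rwa [hs], fun v => by rw [hn]; exact hq v, fun v => cam_ext ?_ ?_⟩
    · rw [camRot_scaledCam, camRot_smul, scaledRot]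
      split_ifs with hv
      · rw [(h0 v hv).1]
      · rw [hn, hsq, hqR]
    · rw [camTrans_scaledCam, camTrans_smul]
      funext a
      rw [scaledTrans, Pi.smul_apply, smul_eq_mul]
      split_ifs with hv hv'
      · rw [(h0 v hv).2, Pi.zero_apply, mul_zero]
      · rw [hv'.2, h1 v hv'.1, mul_one]
      · rw [hst]

end PointLineProblem

/-! ### The joint camera map as a polynomial map -/

theorem map_mulVecLin_smul {t : ℂ} (ht : t ≠ 0) (A : Matrix (Fin 3) (Fin 4) ℂ)
    (W : Submodule ℂ (Fin 4 → ℂ)) : W.map (t • A).mulVecLin = W.map A.mulVecLin := by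
  rw [← Submodule.map_smul A.mulVecLin W t ht]
  congr 1
  exact LinearMap.ext fun x => Matrix.smul_mulVec t A x

theorem isPolyFun_mulVec {σ : Type} {A : (σ → ℂ) → Matrix (Fin 3) (Fin 4) ℂ}
    {x : (σ → ℂ) → Fin 4 → ℂ} (hA : ∀ a k, IsPolyFun fun s => A s a k)
    (hx : ∀ k, IsPolyFun fun s => x s k) (a : Fin 3) : IsPolyFun fun s => (A s).mulVec (x s) a := by
  simp only [Matrix.mulVec, dotProduct]
  exact .sum _ fun k => (hA a k).mul (hx k)

namespace PointLineProblem

variable {m : ℕ} {P : PointLineProblem m}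

theorem isPolyFun_normPart (v : Fin m) : IsPolyFun fun s : P.ParamIndex → ℂ => normPart s v :=
  ((((IsPolyFun.coord _).pow 2).add ((IsPolyFun.coord _).pow 2)).add
    ((IsPolyFun.coord _).pow 2)).add ((IsPolyFun.coord _).pow 2)

theorem isPolyFun_quatMat (a k : Fin 3) : IsPolyFun fun q => quatMat q a k := by
  have h : ∀ i, IsPolyFun fun q : Fin 4 → ℂ => q i := .coord
  have h2 : ∀ i, IsPolyFun fun q : Fin 4 → ℂ => q i ^ 2 := fun i => (h i).pow 2
  have h11 : ∀ i j, IsPolyFun fun q : Fin 4 → ℂ => q i * q j := fun i j => (h i).mul (h j)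
  have h3 : ∀ i j i' j', IsPolyFun fun q : Fin 4 → ℂ => 2 * (q i * q j - q i' * q j') :=
    fun i j i' j' => (IsPolyFun.const 2).mul ((h11 i j).sub (h11 i' j'))
  have h4 : ∀ i j i' j', IsPolyFun fun q : Fin 4 → ℂ => 2 * (q i * q j + q i' * q j') :=
    fun i j i' j' => (IsPolyFun.const 2).mul ((h11 i j).add (h11 i' j'))
  fin_cases a <;> fin_cases k
  · exact (((h2 0).add (h2 1)).sub (h2 2)).sub (h2 3)
  · exact h3 1 2 0 3
  · exact h4 1 3 0 2
  · exact h4 1 2 0 3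
  · exact (((h2 0).sub (h2 1)).add (h2 2)).sub (h2 3)
  · exact h3 2 3 0 1
  · exact h3 1 3 0 2
  · exact h4 2 3 0 1
  · exact (((h2 0).sub (h2 1)).sub (h2 2)).add (h2 3)

theorem isPolyFun_scaledCam (v : Fin m) (a : Fin 3) (k : Fin 4) :
    IsPolyFun fun s : P.ParamIndex → ℂ => scaledCam s v a k := by
  refine Fin.lastCases ?_ (fun k => ?_) k
  · change IsPolyFun fun s : P.ParamIndex → ℂ => camTrans (scaledCam s v) a
    simp only [camTrans_scaledCam, scaledTrans]
    split_ifs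
    · exact .const 0
    · exact isPolyFun_normPart v
    · exact (isPolyFun_normPart v).mul (.coord _)
  · change IsPolyFun fun s : P.ParamIndex → ℂ => camRot (scaledCam s v) a k
    simp only [camRot_scaledCam, scaledRot]
    split_ifs
    · exact (isPolyFun_normPart v).mul (.const _)
    · exact (isPolyFun_quatMat a k).comp fun _ => .coord _

/-- The image of a point. -/
def pointImage (s : P.ParamIndex → ℂ) (w : Σ v, P.obsPt v) : Fin 3 → ℂ :=
  (scaledCam s w.1).mulVec (ptVec (configPart s) w.2)

/-- The images of the two vectors that span a line. -/
noncomputable def lineImage (s : P.ParamIndex → ℂ) (u : Σ v, P.obsLine v) (r : Fin 2) : Fin 3 → ℂ :=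
  (scaledCam s u.1).mulVec
    (if r = 0 then fstVec P.lineInc (configPart s) u.2 else lineVec (configPart s) u.2 1)

theorem WorldRep.map_pt {s : P.ParamIndex → ℂ} {S : World P.p P.l m} (h : WorldRep s S)
    (w : Σ v, P.obsPt v) :
    (S.pt w.2).submodule.map (S.cam w.1).mulVecLin = ℂ ∙ pointImage s w := by
  rw [← map_mulVecLin_smul (h.2.1 w.1), ← h.2.2, h.1.1, Submodule.map_span, Set.image_singleton]
  rfl

theorem WorldRep.map_line {s : P.ParamIndex → ℂ} {S : World P.p P.l m} (h : WorldRep s S)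
    (u : Σ v, P.obsLine v) :
    (S.line u.2).1.map (S.cam u.1).mulVecLin = Submodule.span ℂ {lineImage s u 0, lineImage s u 1} := by
  rw [← map_mulVecLin_smul (h.2.1 u.1), ← h.2.2, h.1.2, Submodule.map_span, Set.image_pair]
  rfl

/-- Index set of the parameters of an arrangement with cameras and of a choice of coordinates of
its joint image. -/
abbrev TotalIndex (P : PointLineProblem m) : Type :=
  P.ParamIndex ⊕ RecoordIndex (Σ v, P.obsPt v) (Σ v, P.obsLine v) 3

/-- Coordinates of the joint image of an arrangement with cameras. -/
noncomputable def jointMap (x : P.TotalIndex → ℂ) : P.ImageIndex → ℂ :=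
  recoord P.imageInc (pointImage fun e => x (.inl e)) (lineImage fun e => x (.inl e))
    fun e => x (.inr e)

theorem isPolyFun_jointMap (e : P.ImageIndex) :
    IsPolyFun fun x : P.TotalIndex → ℂ => jointMap x e := by
  have hinl : ∀ e, IsPolyFun fun x : P.TotalIndex → ℂ => (fun e => x (.inl e) : P.ParamIndex → ℂ) e :=
    fun _ => .coord _
  have hcam : ∀ v a k, IsPolyFun fun x : P.TotalIndex → ℂ => scaledCam (fun e => x (.inl e)) v a k :=
    fun v a k => (isPolyFun_scaledCam v a k).comp hinl
  unfold jointMap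
  refine isPolyFun_recoord (fun w a => isPolyFun_mulVec (hcam _) (fun k => .coord _) a)
    (fun u r a => isPolyFun_mulVec (hcam _) (fun k => ?_) a) (fun _ => .coord _) e
  by_cases hr : r = 0
  · simp only [hr, if_true]
    exact (isPolyFun_fstVec (inc := P.lineInc) u.2.1 k).comp fun e => hinl (.inl e)
  · simp only [hr, if_false]
    exact .coord _

/-- The fibre of the joint camera map in terms of parameters. -/
theorem mem_solutions_iff (hP : P.IsPL1P) {c : P.ImageIndex → ℂ} {y : P.Image} (hc : ImageRep c y)
    {S : World P.p P.l m} : S ∈ P.solutions y ↔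
      ∃ x : P.TotalIndex → ℂ, WorldRep (fun e => x (.inl e)) S ∧ jointMap x = c := by
  constructor
  · rintro ⟨hS, hpt, hline⟩
    obtain ⟨s, hs⟩ := (exists_worldRep_iff hP).2 hS
    -- The vectors computed from `s` and the given coordinates `c` describe the same joint image, so
    -- they differ by a change of coordinates; this is why `g` is among the parameters.
    obtain ⟨g, hg⟩ := hc.exists_recoord_eq (x := pointImage s) (z := lineImage s)
      (fun w => (hpt w.1 w.2).trans (hs.map_pt w)) fun u => (hline u.1 u.2).trans (hs.map_line u)
    exact ⟨Sum.elim s g, hs, hg⟩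
  · rintro ⟨x, hx, rfl⟩
    refine ⟨(exists_worldRep_iff hP).1 ⟨_, hx⟩, ?_⟩
    obtain ⟨h1, h2⟩ := Represents.of_recoord hc (by
      intro w u h
      obtain ⟨hv, hinc⟩ := (imageInc_eq_some_iff hP).1 h
      -- The vector of the point is the first vector of the line, so their images coincide.
      have h3 : pointImage (fun e => x (.inl e)) w = lineImage (fun e => x (.inl e)) u 0 := by
        simp only [pointImage, lineImage, if_true, fstVec, (lineInc_eq_some_iff hP).2 hinc, hv,
          Option.elim_some]
      rw [h3]
      exact Submodule.subset_span (by simp))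
    exact ⟨fun v i => (h1 ⟨v, i⟩).trans (hx.map_pt ⟨v, i⟩).symm,
      fun v j => (h2 ⟨v, j⟩).trans (hx.map_line ⟨v, j⟩).symm⟩

/-! ### Charts -/

/-- A choice of a coordinate for each point and of a Plücker coordinate for each line. -/
abbrev ChartIndex (P : PointLineProblem m) : Type :=
  (Fin P.p → Fin 4) × (Fin P.l → Fin 4 × Fin 4)

/-- The admissible parameters for which the chosen coordinates do not vanish. -/
def chart (κ : P.ChartIndex) : Set (P.ParamIndex → ℂ) :=
  {s | (∀ i, ptVec (configPart s) i (κ.1 i) ≠ 0) ∧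
    (∀ j, minor (fstVec P.lineInc (configPart s) j) (lineVec (configPart s) j 1)
      (κ.2 j).1 (κ.2 j).2 ≠ 0) ∧ ∀ v, normPart s v ≠ 0}

theorem chart_subset_admissible (κ : P.ChartIndex) : chart κ ⊆ P.admissible :=
  fun _ hs => ⟨⟨fun i => ⟨_, hs.1 i⟩, fun j => ⟨_, _, hs.2.1 j⟩⟩, hs.2.2⟩

theorem exists_chart {s : P.ParamIndex → ℂ} (hs : s ∈ P.admissible) : ∃ κ, s ∈ chart κ := by
  obtain ⟨⟨h1, h2⟩, h3⟩ := hs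
  choose k hk using h1
  choose k' l' hkl using h2
  exact ⟨(k, fun j => (k' j, l' j)), hk, hkl, h3⟩

theorem isPolyFun_paramMinor (j : Fin P.l) (k l : Fin 4) :
    IsPolyFun fun s : P.ParamIndex → ℂ =>
      minor (fstVec P.lineInc (configPart s) j) (lineVec (configPart s) j 1) k l :=
  (isPolyFun_minor_fstVec (inc := P.lineInc) j k l).comp fun _ => .coord _

theorem chart_eq (κ : P.ChartIndex) : chart κ =
    (⋂ i, {s | ptVec (configPart s) i (κ.1 i) ≠ 0}) ∩
      ((⋂ j, {s | minor (fstVec P.lineInc (configPart s) j) (lineVec (configPart s) j 1)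
        (κ.2 j).1 (κ.2 j).2 ≠ 0}) ∩ ⋂ v, {s | normPart s v ≠ 0}) := by
  ext s
  simp [chart]

theorem zOpen_chart (κ : P.ChartIndex) : ZOpen (chart κ) := by
  rw [chart_eq]
  exact .inter (.iInter fun i => .ne_zero (.coord _)) (.inter
    (.iInter fun j => .ne_zero (isPolyFun_paramMinor j _ _))
    (.iInter fun v => .ne_zero (isPolyFun_normPart v)))

/-- Normalized coordinates of an arrangement with cameras. -/
noncomputable def normalized (κ : P.ChartIndex) (s : P.ParamIndex → ℂ) : WorldIndex P.p P.l m → ℂ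
  | .inl (i, k) => ptVec (configPart s) i k / ptVec (configPart s) i (κ.1 i)
  | .inr (.inl (j, r, k)) =>
      minor (fstVec P.lineInc (configPart s) j) (lineVec (configPart s) j 1)
        (if r = 0 then (κ.2 j).1 else (κ.2 j).2) k /
      minor (fstVec P.lineInc (configPart s) j) (lineVec (configPart s) j 1) (κ.2 j).1 (κ.2 j).2
  | .inr (.inr (v, a, k)) => scaledCam s v a k / normPart s v

theorem ratOn_normalized (κ : P.ChartIndex) (e : WorldIndex P.p P.l m) :
    RatOn (chart κ) fun s => normalized κ s e := by
  rcases e with ⟨i, k⟩ | ⟨j, r, k⟩ | ⟨v, a, k⟩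
  · exact .div (.coord _) (.coord _) fun s hs => hs.1 i
  · exact .div (isPolyFun_paramMinor j _ _) (isPolyFun_paramMinor j _ _) fun s hs => hs.2.1 j
  · exact .div (isPolyFun_scaledCam v a k) (isPolyFun_normPart v) fun s hs => hs.2.2 v

/-- Two rows of the Plücker matrix through a nonzero minor span the line, and dividing by this minor
removes the choice of basis. These coordinates allow open sets of arrangements to be pulled back to
rational conditions on parameters. -/
theorem worldOfCoords_normalized {κ : P.ChartIndex} {s : P.ParamIndex → ℂ} (hs : s ∈ chart κ)
    {S : World P.p P.l m} (h : WorldRep s S) :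
    ∃ hb : normalized κ s ∈ worldCoords P.p P.l m, worldOfCoords P.p P.l m ⟨_, hb⟩ = S := by
  have hpt : ∀ i, (fun k => normalized κ s (.inl (i, k))) =
      (ptVec (configPart s) i (κ.1 i))⁻¹ • ptVec (configPart s) i := by
    intro i
    funext k
    simp [normalized, div_eq_inv_mul]
  have hline : ∀ j, (fun (r : Fin 2) (k : Fin 4) => normalized κ s (.inr (.inl (j, r, k)))) =
      ![(minor (fstVec P.lineInc (configPart s) j) (lineVec (configPart s) j 1)
          (κ.2 j).1 (κ.2 j).2)⁻¹ • minor (fstVec P.lineInc (configPart s) j)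
          (lineVec (configPart s) j 1) (κ.2 j).1,
        (minor (fstVec P.lineInc (configPart s) j) (lineVec (configPart s) j 1)
          (κ.2 j).1 (κ.2 j).2)⁻¹ • minor (fstVec P.lineInc (configPart s) j)
          (lineVec (configPart s) j 1) (κ.2 j).2] := by
    intro j
    funext r k
    fin_cases r <;> simp [normalized, div_eq_inv_mul]
  have hspan : ∀ j, Submodule.span ℂ
      (Set.range fun (r : Fin 2) (k : Fin 4) => normalized κ s (.inr (.inl (j, r, k)))) =
        (S.line j).1 := by
    intro j
    have hu := isUnit_iff_ne_zero.2 (inv_ne_zero (hs.2.1 j))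
    rw [hline, Matrix.range_cons, Matrix.range_cons, Matrix.range_empty, Set.union_empty,
      Set.singleton_union, h.1.2, span_pair_eq_span_minor (hs.2.1 j), Submodule.span_insert,
      Submodule.span_insert, Submodule.span_singleton_smul_eq hu,
      Submodule.span_singleton_smul_eq hu]
  have hb : normalized κ s ∈ worldCoords P.p P.l m := by
    refine ⟨fun i => ?_, fun j => ?_⟩
    · rw [hpt]
      exact smul_ne_zero (inv_ne_zero (hs.1 i))
        (ptVec_ne_zero_of_mem_nondegenerate h.1.mem_nondegenerate i)
    · rw [linearIndependent_iff_card_eq_finrank_span, Set.finrank, hspan, (S.line j).2]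
      simp
  refine ⟨hb, ?_⟩
  have h1 : (worldOfCoords P.p P.l m ⟨_, hb⟩).pt = S.pt := by
    funext i
    refine Projectivization.submodule_injective ?_
    rw [h.1.1]
    refine (Projectivization.submodule_mk _ _).trans ?_
    simp only [hpt]
    exact Submodule.span_singleton_smul_eq (isUnit_iff_ne_zero.2 (inv_ne_zero (hs.1 i))) _
  have h2 : (worldOfCoords P.p P.l m ⟨_, hb⟩).line = S.line := funext fun j =>
    Subtype.ext (hspan j)
  have h3 : (worldOfCoords P.p P.l m ⟨_, hb⟩).cam = S.cam := by
    funext v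
    ext a k
    change scaledCam s v a k / normPart s v = _
    rw [h.2.2, Matrix.smul_apply, smul_eq_mul, mul_div_cancel_left₀ _ (h.2.1 v)]
  generalize worldOfCoords P.p P.l m ⟨_, hb⟩ = S' at h1 h2 h3
  cases S
  cases S'
  simp only at h1 h2 h3
  rw [h1, h2, h3]

/-- Normalized coordinates only depend on the arrangement with cameras. -/
theorem normalized_eq {κ : P.ChartIndex} {s s' : P.ParamIndex → ℂ} (hs : s ∈ chart κ)
    (hs' : s' ∈ chart κ) {S : World P.p P.l m} (h : WorldRep s S) (h' : WorldRep s' S) :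
    normalized κ s = normalized κ s' := by
  funext e
  rcases e with ⟨i, k⟩ | ⟨j, r, k⟩ | ⟨v, a, k⟩
  · have h1 := (span_singleton_eq_iff (ptVec_ne_zero_of_mem_nondegenerate h.1.mem_nondegenerate i)
      (ptVec_ne_zero_of_mem_nondegenerate h'.1.mem_nondegenerate i)).1
      ((h.1.1 i).symm.trans (h'.1.1 i)) k (κ.1 i)
    simp only [normalized]
    rw [div_eq_div_iff (hs.1 i) (hs'.1 i)]
    simp only [minor] at h1
    linear_combination h1
  · have h1 := (span_pair_eq_iff_minor
      (linearIndependent_of_mem_nondegenerate h.1.mem_nondegenerate j)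
      (linearIndependent_of_mem_nondegenerate h'.1.mem_nondegenerate j)).1
      ((h.1.2 j).symm.trans (h'.1.2 j))
    simp only [normalized]
    rw [div_eq_div_iff (hs.2.1 j) (hs'.2.1 j)]
    linear_combination h1 (if r = 0 then (κ.2 j).1 else (κ.2 j).2) k (κ.2 j).1 (κ.2 j).2
  · simp only [normalized]
    rw [h.2.2, h'.2.2, Matrix.smul_apply, Matrix.smul_apply, smul_eq_mul, smul_eq_mul,
      mul_div_cancel_left₀ _ (h.2.1 v), mul_div_cancel_left₀ _ (h'.2.1 v)]

end PointLineProblem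

/-! ### Generic fibres and open subsets of the domain -/

namespace PointLineProblem

variable {m : ℕ} {P : PointLineProblem m}

theorem cstr_chart (κ : P.ChartIndex) : Cstr (chart κ) := by
  rw [chart_eq]
  exact .inter (.iInter fun i => .ne_zero (.coord _)) (.inter
    (.iInter fun j => .ne_zero (isPolyFun_paramMinor j _ _))
    (.iInter fun v => .ne_zero (isPolyFun_normPart v)))

theorem isPolyFun_inl (e : P.ParamIndex) :
    IsPolyFun fun x : P.TotalIndex → ℂ => (fun e => x (.inl e) : P.ParamIndex → ℂ) e :=
  .coord _

/-- If the part in `U` of the generic fibre of the joint camera map is finite, then `U` contains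
the generic fibre, because the domain is irreducible. -/
theorem solutions_subset_of_finite (hP : P.IsPL1P) {U : Set (World P.p P.l m)} (hU : IsOpen U)
    (hne : (P.domain ∩ U).Nonempty)
    (hfin : ∃ O : Set (P.ImageIndex → ℂ), ZOpen O ∧ O.Nonempty ∧
      ∀ c ∈ O, ∀ y, ImageRep c y → (P.solutions y ∩ U).Finite) :
    ∃ O : Set (P.ImageIndex → ℂ), ZOpen O ∧ O.Nonempty ∧
      ∀ c ∈ O, ∀ y, ImageRep c y → P.solutions y ⊆ U := by
  obtain ⟨Ofin, hOfin, hOfinne, hfin⟩ := hfin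
  obtain ⟨V, hV, hVU⟩ := isOpen_zariskiQuotient_iff.1 hU
  have hmem : ∀ {κ : P.ChartIndex} {s S}, s ∈ chart κ → WorldRep s S →
      (normalized κ s ∈ V ↔ S ∈ U) := by
    intro κ s S hs h
    obtain ⟨hb, rfl⟩ := worldOfCoords_normalized hs h
    exact hVU ⟨_, hb⟩
  -- Around a parameter of an arrangement in `U`, membership in `U` follows from the nonvanishing of
  -- one rational function `G / D`. Its expression through `F` shows that its value depends only on
  -- the arrangement.
  have hpre : ∀ (κ : P.ChartIndex), ∀ s ∈ chart κ, normalized κ s ∈ V →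
      ∃ (G D : (P.ParamIndex → ℂ) → ℂ) (F : (WorldIndex P.p P.l m → ℂ) → ℂ),
      IsPolyFun G ∧ IsPolyFun D ∧
      (∀ s ∈ chart κ, D s ≠ 0 ∧ F (normalized κ s) = G s / D s) ∧ G s ≠ 0 ∧ ∀ b, F b ≠ 0 → b ∈ V := by
    intro κ s hs hsV
    obtain ⟨F, hF, hFs, hFV⟩ := hV _ hsV
    obtain ⟨G, D, hG, hD, hGD⟩ := RatOn.comp hF (ratOn_normalized κ)
    refine ⟨G, D, F, hG, hD, hGD, fun h0 => hFs ((hGD s hs).2.trans ?_), hFV⟩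
    rw [h0, zero_div]
  obtain ⟨S0, hS0, hS0U⟩ := hne
  obtain ⟨s0, hs0⟩ := (exists_worldRep_iff hP).2 hS0
  obtain ⟨κ0, hκ0⟩ := exists_chart hs0.mem_admissible
  obtain ⟨G0, D0, F0, hG0, hD0, hGD0, hG0s, hF0V⟩ := hpre κ0 s0 hκ0 ((hmem hκ0 hs0).2 hS0U)
  have key : ∀ κ : P.ChartIndex, ∃ O : Set (P.ImageIndex → ℂ), ZOpen O ∧ O.Nonempty ∧
      ∀ x : P.TotalIndex → ℂ, (fun e => x (.inl e)) ∈ chart κ →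
        ∀ S, WorldRep (fun e => x (.inl e)) S → S ∉ U → jointMap x ∉ O := by
    intro κ
    by_cases hκ : (chart κ).Nonempty
    swap
    · exact ⟨Set.univ, .univ, Set.univ_nonempty, fun x hx => absurd ⟨_, hx⟩ hκ⟩
    -- Irreducibility of the parameter space moves a point of `U` into every nonempty chart.
    obtain ⟨s1, ⟨hs1κ0, hs1G⟩, hs1⟩ := ((zOpen_chart κ0).inter (.ne_zero hG0)).inter_nonempty
      (zOpen_chart κ) ⟨s0, hκ0, hG0s⟩ hκ
    obtain ⟨S1, hS1⟩ := exists_worldRep_of_mem_admissible (chart_subset_admissible κ hs1)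
    have hS1U : S1 ∈ U := by
      refine (hmem hs1κ0 hS1).1 (hF0V _ ?_)
      rw [(hGD0 s1 hs1κ0).2]
      exact div_ne_zero hs1G (hGD0 s1 hs1κ0).1
    obtain ⟨G, D, F, hG, hD, hGD, hGs, hFV⟩ := hpre κ s1 hs1 ((hmem hs1 hS1).2 hS1U)
    -- In this chart the complement of `U` is contained in the zero set of `G`.
    rcases avoids_or_infinite_values (σ := P.TotalIndex) (Ψ := jointMap) isPolyFun_jointMap
      ((zOpen_chart κ).preimage isPolyFun_inl) ((cstr_chart κ).preimage isPolyFun_inl)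
      (hG.comp isPolyFun_inl) (hD.comp isPolyFun_inl) (fun x hx => (hGD _ hx).1)
      ⟨Sum.elim s1 0, hs1, hGs⟩ with ⟨O, hO, hOne, h⟩ | ⟨O, hO, hOne, h⟩
    · refine ⟨O, hO, hOne, fun x hx S hS hSU => h x hx ?_⟩
      by_contra hGx
      refine hSU ((hmem hx hS).1 (hFV _ ?_))
      rw [(hGD _ hx).2]
      exact div_ne_zero hGx (hGD _ hx).1
    · exfalso
      obtain ⟨c1, hc1⟩ := nondegenerate_nonempty (n := 3) (by norm_num) P.imageInc
      obtain ⟨c, ⟨hcO, hcfin⟩, hc⟩ := (hO.inter hOfin).inter_nonempty zOpen_nondegenerate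
        (hO.inter_nonempty hOfin hOne hOfinne) ⟨c1, hc1⟩
      obtain ⟨y, hy⟩ := exists_imageRep_of_mem_nondegenerate hc
      -- The value 0 is discarded because only nonzero values certify membership in `U`.
      have hinf := (h c hcO).sdiff (Set.finite_singleton 0)
      have hex : ∀ t ∈ {t : ℂ | ∃ x ∈ (fun (x : P.TotalIndex → ℂ) e => x (.inl e)) ⁻¹' chart κ,
          jointMap x = c ∧ G (fun e => x (.inl e)) = t * D (fun e => x (.inl e))} \ {0},
          ∃ s ∈ chart κ, ∃ S ∈ P.solutions y ∩ U, WorldRep s S ∧ F (normalized κ s) = t := by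
        rintro t ⟨⟨x, hx, hxc, hxt⟩, ht⟩
        obtain ⟨S, hS⟩ := exists_worldRep_of_mem_admissible (chart_subset_admissible κ hx)
        have hFt : F (normalized κ fun e => x (.inl e)) = t := by
          rw [(hGD _ hx).2, div_eq_iff (hGD _ hx).1]
          exact hxt
        refine ⟨_, hx, S, ⟨(mem_solutions_iff hP hy).2 ⟨x, hS, hxc⟩, (hmem hx hS).1 (hFV _ ?_)⟩,
          hS, hFt⟩
        rw [hFt]
        exact ht
      have : Nonempty (World P.p P.l m) := ⟨S0⟩
      choose! s hs S hS hsS hF using hex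
      -- Infinitely many values on finitely many solutions: two distinct values would belong to one
      -- arrangement.
      obtain ⟨t, ht, u, hu, htu, hSeq⟩ := hinf.exists_ne_map_eq_of_mapsTo hS (hfin c hcfin y hy)
      refine htu ?_
      rw [← hF t ht, ← hF u hu, normalized_eq (hs t ht) (hs u hu) (hsS t ht) (hSeq ▸ hsS u hu)]
  choose O hO hOne h using key
  have hfinite : ∀ s : Finset P.ChartIndex, (⋂ κ ∈ s, O κ).Nonempty ∧ ZOpen (⋂ κ ∈ s, O κ) := by
    classical
    intro s
    induction s using Finset.induction_on with
    | empty => simpa using ZOpen.univ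
    | insert κ s _ ih =>
      rw [Finset.set_biInter_insert]
      exact ⟨(hO κ).inter_nonempty ih.2 (hOne κ) ih.1, (hO κ).inter ih.2⟩
  refine ⟨_, (hfinite Finset.univ).2, (hfinite Finset.univ).1, fun c hc y hy S hS => ?_⟩
  by_contra hSU
  obtain ⟨x, hx, rfl⟩ := (mem_solutions_iff hP hy).1 hS
  obtain ⟨κ, hκ⟩ := exists_chart hx.mem_admissible
  simp only [Finset.mem_univ, Set.iInter_true, Set.mem_iInter] at hc
  exact h κ x hκ S hx hSU (hc κ)

/-! ### The degree -/

/-- All comparisons are cleared of denominators, which makes distinctness a constructible condition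
on a pair of parameter vectors. -/
theorem ne_iff_of_worldRep {s s' : P.ParamIndex → ℂ} {S S' : World P.p P.l m} (h : WorldRep s S)
    (h' : WorldRep s' S') : S ≠ S' ↔
      (∃ i k l, minor (ptVec (configPart s) i) (ptVec (configPart s') i) k l ≠ 0) ∨
      (∃ j k l k' l', minor (fstVec P.lineInc (configPart s) j) (lineVec (configPart s) j 1) k l *
          minor (fstVec P.lineInc (configPart s') j) (lineVec (configPart s') j 1) k' l' ≠
        minor (fstVec P.lineInc (configPart s) j) (lineVec (configPart s) j 1) k' l' *
          minor (fstVec P.lineInc (configPart s') j) (lineVec (configPart s') j 1) k l) ∨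
      ∃ v a k, scaledCam s v a k * normPart s' v ≠ scaledCam s' v a k * normPart s v := by
  have hpt : S.pt = S'.pt ↔
      ∀ i k l, minor (ptVec (configPart s) i) (ptVec (configPart s') i) k l = 0 := by
    rw [funext_iff]
    refine forall_congr' fun i => ?_
    rw [← span_singleton_eq_iff (ptVec_ne_zero_of_mem_nondegenerate h.1.mem_nondegenerate i)
      (ptVec_ne_zero_of_mem_nondegenerate h'.1.mem_nondegenerate i), ← h.1.1, ← h'.1.1]
    exact Projectivization.submodule_injective.eq_iff.symm
  have hline : S.line = S'.line ↔ ∀ j k l k' l',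
      minor (fstVec P.lineInc (configPart s) j) (lineVec (configPart s) j 1) k l *
          minor (fstVec P.lineInc (configPart s') j) (lineVec (configPart s') j 1) k' l' =
        minor (fstVec P.lineInc (configPart s) j) (lineVec (configPart s) j 1) k' l' *
          minor (fstVec P.lineInc (configPart s') j) (lineVec (configPart s') j 1) k l := by
    rw [funext_iff]
    refine forall_congr' fun j => ?_
    rw [← span_pair_eq_iff_minor (linearIndependent_of_mem_nondegenerate h.1.mem_nondegenerate j)
      (linearIndependent_of_mem_nondegenerate h'.1.mem_nondegenerate j), ← h.1.2, ← h'.1.2]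
    exact Subtype.ext_iff
  have hcam : S.cam = S'.cam ↔
      ∀ v a k, scaledCam s v a k * normPart s' v = scaledCam s' v a k * normPart s v := by
    rw [funext_iff]
    refine forall_congr' fun v => ?_
    rw [← Matrix.ext_iff]
    refine forall_congr' fun a => forall_congr' fun k => ?_
    rw [h.2.2, h'.2.2, Matrix.smul_apply, Matrix.smul_apply, smul_eq_mul, smul_eq_mul]
    have h1 := h.2.1 v
    have h2 := h'.2.1 v
    constructor
    · intro h3
      rw [h3]
      ring
    · intro h3
      refine mul_left_cancel₀ (mul_ne_zero h1 h2) ?_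
      linear_combination h3
  have hext : S = S' ↔ S.pt = S'.pt ∧ S.line = S'.line ∧ S.cam = S'.cam := by
    cases S
    cases S'
    simp
  rw [ne_eq, hext, hpt, hline, hcam]
  simp only [not_and_or, not_forall, ne_eq]

/-- Having at least `n` solutions is a generic property, or its negation is. -/
theorem le_encard_solutions_dichotomy (hP : P.IsPL1P) (n : ℕ) :
    (∃ O : Set (P.ImageIndex → ℂ), ZOpen O ∧ O.Nonempty ∧
      ∀ c ∈ O, ∀ y, ImageRep c y → (n : ℕ∞) ≤ (P.solutions y).encard) ∨
    ∃ O : Set (P.ImageIndex → ℂ), ZOpen O ∧ O.Nonempty ∧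
      ∀ c ∈ O, ∀ y, ImageRep c y → ¬ (n : ℕ∞) ≤ (P.solutions y).encard := by
  let proj : Fin n → (P.ImageIndex ⊕ (Fin n × P.TotalIndex) → ℂ) → P.TotalIndex → ℂ :=
    fun r x e => x (.inr (r, e))
  let par : Fin n → (P.ImageIndex ⊕ (Fin n × P.TotalIndex) → ℂ) → P.ParamIndex → ℂ :=
    fun r x e => x (.inr (r, .inl e))
  have hpar : ∀ r e, IsPolyFun fun x => par r x e := fun r e => .coord _
  have hpt : ∀ r i k, IsPolyFun fun x => ptVec (configPart (par r x)) i k := fun r i k => .coord _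
  have hminor : ∀ r j k l, IsPolyFun fun x => minor (fstVec P.lineInc (configPart (par r x)) j)
      (lineVec (configPart (par r x)) j 1) k l := fun r j k l =>
    (isPolyFun_paramMinor j k l).comp (hpar r)
  have hcam : ∀ r v a k, IsPolyFun fun x => scaledCam (par r x) v a k := fun r v a k =>
    (isPolyFun_scaledCam v a k).comp (hpar r)
  have hnorm : ∀ r v, IsPolyFun fun x => normPart (par r x) v := fun r v =>
    (isPolyFun_normPart v).comp (hpar r)
  -- A joint image together with `n` parameter vectors over it whose arrangements are pairwise
  -- distinct; its projection consists of the joint images with at least `n` solutions.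
  let Z : Set (P.ImageIndex ⊕ (Fin n × P.TotalIndex) → ℂ) :=
    (⋂ r, ⋃ κ, par r ⁻¹' chart κ) ∩ ((⋂ r, ⋂ e, {x | jointMap (proj r x) e = x (.inl e)}) ∩
      ⋂ q : {q : Fin n × Fin n // q.1 ≠ q.2},
        ((⋃ i, ⋃ k, ⋃ l, {x | minor (ptVec (configPart (par q.1.1 x)) i)
          (ptVec (configPart (par q.1.2 x)) i) k l ≠ 0}) ∪
        ((⋃ j, ⋃ k, ⋃ l, ⋃ k', ⋃ l',
          {x | minor (fstVec P.lineInc (configPart (par q.1.1 x)) j)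
              (lineVec (configPart (par q.1.1 x)) j 1) k l *
            minor (fstVec P.lineInc (configPart (par q.1.2 x)) j)
              (lineVec (configPart (par q.1.2 x)) j 1) k' l' ≠
            minor (fstVec P.lineInc (configPart (par q.1.1 x)) j)
              (lineVec (configPart (par q.1.1 x)) j 1) k' l' *
            minor (fstVec P.lineInc (configPart (par q.1.2 x)) j)
              (lineVec (configPart (par q.1.2 x)) j 1) k l}) ∪
        ⋃ v, ⋃ a, ⋃ k, {x | scaledCam (par q.1.1 x) v a k * normPart (par q.1.2 x) v ≠
          scaledCam (par q.1.2 x) v a k * normPart (par q.1.1 x) v})))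
  have hZ : Cstr Z := by
    refine .inter (.iInter fun r => .iUnion fun κ => (cstr_chart κ).preimage (hpar r)) (.inter
      (.iInter fun r => .iInter fun e => .eq ((isPolyFun_jointMap e).comp fun _ => .coord _)
        (.coord _)) (.iInter fun q => .union ?_ (.union ?_ ?_)))
    · exact .iUnion fun i => .iUnion fun k => .iUnion fun l => .ne_zero
        (((hpt q.1.1 i k).mul (hpt q.1.2 i l)).sub ((hpt q.1.1 i l).mul (hpt q.1.2 i k)))
    · exact .iUnion fun j => .iUnion fun k => .iUnion fun l => .iUnion fun k' => .iUnion fun l' =>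
        .ne ((hminor q.1.1 j k l).mul (hminor q.1.2 j k' l')) ((hminor q.1.1 j k' l').mul
          (hminor q.1.2 j k l))
    · exact .iUnion fun v => .iUnion fun a => .iUnion fun k =>
        .ne ((hcam q.1.1 v a k).mul (hnorm q.1.2 v)) ((hcam q.1.2 v a k).mul (hnorm q.1.1 v))
  have hmem : ∀ c y, ImageRep c y →
      ((∃ x, Sum.elim c x ∈ Z) ↔ (n : ℕ∞) ≤ (P.solutions y).encard) := by
    intro c y hy
    constructor
    · rintro ⟨x, h1, h2, h3⟩
      simp only [Set.mem_iInter, Set.mem_iUnion] at h1 h2 h3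
      have h4 : ∀ r, ∃ S, WorldRep (par r (Sum.elim c x)) S := fun r =>
        exists_worldRep_of_mem_admissible (chart_subset_admissible _ (h1 r).choose_spec)
      choose S hS using h4
      have hinj : Function.Injective S := by
        intro r r' hrr'
        by_contra hne
        refine (ne_iff_of_worldRep (hS r) (hS r')).2 ?_ hrr'
        simpa only [Set.mem_union, Set.mem_iUnion, Set.mem_ofPred_eq] using h3 ⟨(r, r'), hne⟩
      have hsub : Set.range S ⊆ P.solutions y := by
        rintro _ ⟨r, rfl⟩
        exact (mem_solutions_iff hP hy).2 ⟨proj r (Sum.elim c x), hS r, funext (h2 r)⟩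
      refine le_trans ?_ (Set.encard_le_encard hsub)
      rw [← Set.image_univ, hinj.encard_image, Set.encard_univ]
      simp
    · intro hn
      obtain ⟨T, hT, hTn⟩ := Set.exists_subset_encard_eq hn
      have hTfin : T.Finite := Set.finite_of_encard_eq_coe hTn
      have := hTfin.fintype
      have hcard : Fintype.card T = n := by
        rw [← Set.toFinset_card, ← Set.ncard_eq_toFinset_card', Set.ncard, hTn, ENat.toNat_natCast]
      let e := (Fintype.equivFinOfCardEq hcard).symm
      choose x hx hxc using fun r => (mem_solutions_iff hP hy).1 (hT (e r).2)
      refine ⟨fun e => x e.1 e.2, ?_, ?_, ?_⟩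
      · simp only [Set.mem_iInter, Set.mem_iUnion]
        exact fun r => exists_chart (hx r).mem_admissible
      · simp only [Set.mem_iInter]
        exact fun r e => congrFun (hxc r) e
      · simp only [Set.mem_iInter]
        rintro ⟨⟨r, r'⟩, hrr'⟩
        have := (ne_iff_of_worldRep (hx r) (hx r')).1 fun h => hrr' (e.injective (Subtype.ext h))
        simp only [Set.mem_union, Set.mem_iUnion, Set.mem_ofPred_eq]
        exact this
  rcases hZ.projection_dichotomy with ⟨O, hO, hne, h⟩ | ⟨O, hO, hne, h⟩
  · exact .inl ⟨O, hO, hne, fun c hc y hy => (hmem c y hy).1 (h c hc)⟩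
  · exact .inr ⟨O, hO, hne, fun c hc y hy hn => by
      obtain ⟨x, hx⟩ := (hmem c y hy).2 hn
      exact h c hc x hx⟩

/-- The degree is the largest `n` such that at least `n` solutions exist generically. There is such
an `n`: otherwise countably many nonempty open sets would share a joint image whose finite number of
solutions exceeds every bound. -/
theorem exists_hasDegree (hP : P.IsPL1P)
    (hfin : Generically P.imageVariety fun y => (P.solutions y).Finite) : ∃ d, P.HasDegree d := by
  classical
  obtain ⟨Of, hOf, hOfne, hf⟩ := (generically_imageVariety_iff hP).1 hfin
  let A : ℕ → Prop := fun n => ∃ O : Set (P.ImageIndex → ℂ), ZOpen O ∧ O.Nonempty ∧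
    ∀ c ∈ O, ∀ y, ImageRep c y → (n : ℕ∞) ≤ (P.solutions y).encard
  have hex : ∃ n, ¬ A n := by
    by_contra! hA
    choose O hO hOne h using hA
    have hnd := nondegenerate_nonempty (n := 3) (by norm_num) P.imageInc
    have hOf' := hOf.inter (zOpen_nondegenerate (inc := P.imageInc) (n := 3))
    obtain ⟨c, hc⟩ := ZOpen.iInter_nat_nonempty (fun n => (hO n).inter hOf') fun n =>
      (hO n).inter_nonempty hOf' (hOne n) (hOf.inter_nonempty zOpen_nondegenerate hOfne hnd)
    rw [Set.mem_iInter] at hc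
    obtain ⟨y, hy⟩ := exists_imageRep_of_mem_nondegenerate (hc 0).2.2
    have h1 := (hf c (hc 0).2.1 y hy).encard_eq_coe
    have h2 := h _ c (hc ((P.solutions y).ncard + 1)).1 y hy
    rw [h1] at h2
    norm_cast at h2
    have : (P.solutions y).encard.toNat = (P.solutions y).ncard := rfl
    omega
  have hA0 : A 0 := ⟨Set.univ, .univ, Set.univ_nonempty, fun _ _ _ _ => by simp⟩
  -- `Nat.find hex` is the first number that fails; it is not 0, and its predecessor is the degree.
  obtain ⟨d, hd⟩ := Nat.exists_eq_succ_of_ne_zero (n := Nat.find hex) fun h0 =>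
    Nat.find_spec hex (h0 ▸ hA0)
  have hAd : A d := not_not.1 (Nat.find_min hex (by omega))
  have hAd' : ¬ A (d + 1) := by
    have := Nat.find_spec hex
    rwa [hd] at this
  obtain ⟨O, hO, hOne, h⟩ := hAd
  obtain ⟨O', hO', hOne', h'⟩ := (le_encard_solutions_dichotomy hP (d + 1)).resolve_left hAd'
  refine ⟨d, (generically_imageVariety_iff hP).2 ⟨O ∩ O', hO.inter hO',
    hO.inter_nonempty hO' hOne hOne', fun c hc y hy => ?_⟩⟩
  refine le_antisymm ?_ (h c hc.1 y hy)
  have h2 := h' c hc.2 y hy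
  rw [not_le] at h2
  push_cast at h2
  exact Order.le_of_lt_add_one h2

/-- Finitely many solutions are distinguished by their cameras: two solutions with the same
cameras span a pencil of solutions. -/
theorem eq_of_cam_eq (hP : P.IsPL1P) {y : P.Image} (hfin : (P.solutions y).Finite)
    {S S' : World P.p P.l m} (hS : S ∈ P.solutions y) (hS' : S' ∈ P.solutions y)
    (hcam : S.cam = S'.cam) : S = S' := by
  obtain ⟨c, hc⟩ := exists_represents (inc := P.lineInc) (pt := S.pt) (line := S.line)
    fun i j hij => hS.1.1 i j ((lineInc_eq_some_iff hP).1 hij)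
  obtain ⟨c', hc'⟩ := exists_represents (inc := P.lineInc) (pt := S'.pt) (line := S'.line)
    fun i j hij => hS'.1.1 i j ((lineInc_eq_some_iff hP).1 hij)
  have hpt : ∀ v (i : P.obsPt v), (y.pt v i).submodule =
      ℂ ∙ (S.cam v).mulVecLin (ptVec c i) := by
    intro v i
    rw [hS.2.1, hc.1, Submodule.map_span, Set.image_singleton]
  have hpt' : ∀ v (i : P.obsPt v), (S.cam v).mulVecLin (ptVec c' i) ∈ (y.pt v i).submodule := by
    intro v i
    rw [hS'.2.1, hcam]
    exact Submodule.mem_map_of_mem (hc'.ptVec_mem i)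
  have hline : ∀ v (j : P.obsLine v), (y.line v j).1 = Submodule.span ℂ
      {(S.cam v).mulVecLin (fstVec P.lineInc c j), (S.cam v).mulVecLin (lineVec c j 1)} := by
    intro v j
    rw [hS.2.2, hc.2, Submodule.map_span, Set.image_pair]
  have hline' : ∀ v (j : P.obsLine v),
      (S.cam v).mulVecLin (fstVec P.lineInc c' j) ∈ (y.line v j).1 ∧
        (S.cam v).mulVecLin (lineVec c' j 1) ∈ (y.line v j).1 := by
    intro v j
    rw [hS'.2.2, hcam]
    exact ⟨Submodule.mem_map_of_mem (hc'.fstVec_mem j), Submodule.mem_map_of_mem (hc'.lineVec_mem j)⟩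
  -- All but finitely many members of the pencil are nondegenerate and have nondegenerate images.
  obtain ⟨B, hB, hBc⟩ : ∃ B : Set ℂ, B.Finite ∧ ∀ t ∈ Bᶜ, c + t • c' ∈ nondegenerate P.lineInc 4 ∧
      (∀ w : Σ v, P.obsPt v, (S.cam w.1).mulVecLin (ptVec c w.2) +
        t • (S.cam w.1).mulVecLin (ptVec c' w.2) ≠ 0) ∧
      ∀ u : Σ v, P.obsLine v, LinearIndependent ℂ
        ![(S.cam u.1).mulVecLin (fstVec P.lineInc c u.2) +
            t • (S.cam u.1).mulVecLin (fstVec P.lineInc c' u.2),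
          (S.cam u.1).mulVecLin (lineVec c u.2 1) +
            t • (S.cam u.1).mulVecLin (lineVec c' u.2 1)] := by
    refine ⟨_, (hc.finite_setOf_degenerate c').union
      ((Set.finite_iUnion fun w : Σ v, P.obsPt v => finite_setOf_add_smul_eq_zero
        (ProjPoint.ne_zero (hpt w.1 w.2)) ((S.cam w.1).mulVecLin (ptVec c' w.2))).union
      (Set.finite_iUnion fun u : Σ v, P.obsLine v => finite_setOf_not_linearIndependent
        (ProjLine.linearIndependent (hline u.1 u.2))
        ((S.cam u.1).mulVecLin (fstVec P.lineInc c' u.2))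
        ((S.cam u.1).mulVecLin (lineVec c' u.2 1)))), fun t ht => ?_⟩
    simp only [Set.mem_compl_iff, Set.mem_union, Set.mem_iUnion, not_or, not_exists] at ht
    exact ⟨not_not.1 ht.1, ht.2.1, fun u => not_not.1 (ht.2.2 u)⟩
  -- With the cameras fixed, lying on the given image points and lines is linear in the coordinates,
  -- and incidences are built into them. So such members again solve for `y`.
  have hex : ∀ t ∈ Bᶜ, ∃ S'' ∈ P.solutions y,
      Represents P.lineInc (c + t • c') S''.pt S''.line := by
    intro t ht
    obtain ⟨h1, h2, h3⟩ := hBc t ht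
    obtain ⟨pt, line, h⟩ := exists_represents_of_mem_nondegenerate h1
    refine ⟨⟨pt, line, S.cam⟩, ⟨⟨fun i j hij => h.incident ((lineInc_eq_some_iff hP).2 hij),
      hS.1.2⟩, fun v i => ?_, fun v j => ?_⟩, h⟩
    · have h4 : (S.cam v).mulVecLin (ptVec (c + t • c') i) = (S.cam v).mulVecLin (ptVec c i) +
          t • (S.cam v).mulVecLin (ptVec c' i) := by
        rw [← map_smul, ← map_add]
        rfl
      simp only
      rw [h.1, Submodule.map_span, Set.image_singleton, h4]
      refine ProjPoint.submodule_eq_span (h2 ⟨v, i⟩) (Submodule.add_mem _ ?_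
        (Submodule.smul_mem _ _ (hpt' v i)))
      rw [hpt]
      exact Submodule.mem_span_singleton_self _
    · have h4 : (S.cam v).mulVecLin (fstVec P.lineInc (c + t • c') j) =
          (S.cam v).mulVecLin (fstVec P.lineInc c j) +
          t • (S.cam v).mulVecLin (fstVec P.lineInc c' j) := by
        rw [← map_smul, ← map_add, fstVec_add_smul]
      have h5 : (S.cam v).mulVecLin (lineVec (c + t • c') j 1) =
          (S.cam v).mulVecLin (lineVec c j 1) + t • (S.cam v).mulVecLin (lineVec c' j 1) := by
        rw [← map_smul, ← map_add]
        rfl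
      simp only
      rw [h.2, Submodule.map_span, Set.image_pair, h4, h5]
      refine span_pair_eq_of_linearIndependent (y.line v j).2 (h3 ⟨v, j⟩)
        (Submodule.add_mem _ ?_ (Submodule.smul_mem _ _ (hline' v j).1))
        (Submodule.add_mem _ ?_ (Submodule.smul_mem _ _ (hline' v j).2)) <;>
      · rw [hline]
        exact Submodule.subset_span (by simp)
  have : Nonempty (World P.p P.l m) := ⟨S⟩
  choose! T hT hTrep using hex
  -- Finiteness makes two members of the pencil equal, which happens only if its two generators
  -- describe the same arrangement.
  obtain ⟨t, ht, u, hu, htu, hTtu⟩ := hB.infinite_compl.exists_ne_map_eq_of_mapsTo hT hfin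
  have h1 := hTrep t ht
  have h2 := hTrep u hu
  rw [hTtu] at h1
  obtain ⟨h3, h4⟩ := hc.pencil_injective hc' htu h1 h2
  cases S
  cases S'
  simp only at hcam h3 h4
  rw [hcam, h3, h4]

end PointLineProblem

/-! ### Forgetting points and lines -/

section Restriction

variable {α β α' β' : Type} {n : ℕ}

/-- The index of a coordinate of the first spanning vector of a line. -/
def fstIndex (inc : β → Option α) (j : β) (k : Fin n) : ConfigIndex α β n :=
  (inc j).elim (.inr (j, 0, k)) fun i => .inl (i, k)

theorem fstVec_eq_fstIndex (inc : β → Option α) (c : ConfigIndex α β n → ℂ) (j : β) (k : Fin n) :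
    fstVec inc c j k = c (fstIndex inc j k) := by
  unfold fstVec fstIndex
  cases inc j <;> rfl

/-- The coordinates of a configuration that describe its restriction to the points `a i` and the
lines `b j`. -/
def restrictIndex (inc : β → Option α) (inc' : β' → Option α') (a : α' → α) (b : β' → β) :
    ConfigIndex α' β' n → ConfigIndex α β n
  | .inl (i, k) => .inl (a i, k)
  | .inr (j, r, k) => if r = 0 ∧ inc' j = none then fstIndex inc (b j) k else .inr (b j, r, k)

variable {inc : β → Option α} {inc' : β' → Option α'} {a : α' → α} {b : β' → β}

/-- A collision needs a line that borrows its first vector from a point. If that point is kept,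
`hforget` excludes it; if two lines borrow from one point, `hpin` identifies them. -/
theorem restrictIndex_injective (ha : a.Injective) (hb : b.Injective)
    (hforget : ∀ i j, inc' j = none → inc (b j) ≠ some (a i))
    (hpin : ∀ w j j', inc' j = none → inc' j' = none → inc (b j) = some w → inc (b j') = some w →
      j = j') :
    (restrictIndex (n := n) inc inc' a b).Injective := by
  have key : ∀ j k, inc' j = none → (fstIndex (n := n) inc (b j) k = .inr (b j, 0, k) ∨
      ∃ w, inc (b j) = some w ∧ fstIndex (n := n) inc (b j) k = .inl (w, k)) := by
    intro j k _
    unfold fstIndex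
    cases inc (b j) with
    | none => exact .inl rfl
    | some w => exact .inr ⟨w, rfl, rfl⟩
  rintro (⟨i, k⟩ | ⟨j, r, k⟩) (⟨i', k'⟩ | ⟨j', r', k'⟩) h
  · simp only [restrictIndex, Sum.inl.injEq, Prod.mk.injEq] at h
    rw [ha h.1, h.2]
  · simp only [restrictIndex] at h
    split_ifs at h with hr
    rcases key j' k' hr.2 with h1 | ⟨w, hw, h1⟩ <;> rw [h1] at h
    · simp at h
    · simp only [Sum.inl.injEq, Prod.mk.injEq] at h
      exact absurd (h.1 ▸ hw) (hforget i j' hr.2)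
  · simp only [restrictIndex] at h
    split_ifs at h with hr
    rcases key j k hr.2 with h1 | ⟨w, hw, h1⟩ <;> rw [h1] at h
    · simp at h
    · simp only [Sum.inl.injEq, Prod.mk.injEq] at h
      exact absurd (h.1 ▸ hw) (hforget i' j hr.2)
  · simp only [restrictIndex] at h
    split_ifs at h with hr hr' hr'
    · rcases key j k hr.2 with h1 | ⟨w, hw, h1⟩ <;>
        rcases key j' k' hr'.2 with h2 | ⟨w', hw', h2⟩ <;> rw [h1, h2] at h
      · simp only [Sum.inr.injEq, Prod.mk.injEq] at h
        rw [hb h.1, h.2.2, hr.1, hr'.1]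
      · simp at h
      · simp at h
      · simp only [Sum.inl.injEq, Prod.mk.injEq] at h
        rw [hpin w j j' hr.2 hr'.2 hw (h.1 ▸ hw'), h.2, hr.1, hr'.1]
    · rcases key j k hr.2 with h1 | ⟨w, hw, h1⟩ <;> rw [h1] at h
      · simp only [Sum.inr.injEq, Prod.mk.injEq] at h
        exact absurd ⟨h.2.1.symm, hb h.1 ▸ hr.2⟩ hr'
      · simp at h
    · rcases key j' k' hr'.2 with h1 | ⟨w, hw, h1⟩ <;> rw [h1] at h
      · simp only [Sum.inr.injEq, Prod.mk.injEq] at h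
        exact absurd ⟨h.2.1, hb h.1 ▸ hr'.2⟩ hr
      · simp at h
    · simp only [Sum.inr.injEq, Prod.mk.injEq] at h
      rw [hb h.1, h.2.1, h.2.2]

/-- A kept line that loses its point takes over the vector of that point as its own first vector. -/
theorem Represents.restrict {c : ConfigIndex α β n → ℂ} {pt : α → ProjPoint n}
    {line : β → ProjLine n} (h : Represents inc c pt line)
    (hkept : ∀ i j, inc' j = some i → inc (b j) = some (a i)) :
    Represents inc' (c ∘ restrictIndex inc inc' a b) (fun i => pt (a i)) fun j => line (b j) := by
  refine ⟨fun i => h.1 (a i), fun j => ?_⟩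
  have h1 : lineVec (c ∘ restrictIndex inc inc' a b) j 1 = lineVec c (b j) 1 := by
    funext k
    simp [lineVec, restrictIndex]
  have h2 : fstVec inc' (c ∘ restrictIndex inc inc' a b) j = fstVec inc c (b j) := by
    funext k
    cases hj : inc' j with
    | none => simp [fstVec_eq_fstIndex, fstIndex, restrictIndex, hj]
    | some i => simp [fstVec_eq_fstIndex, fstIndex, restrictIndex, hj, hkept i j hj]
  rw [h1, h2]
  exact h.2 (b j)

end Restriction

theorem isPolyFun_extend {σ τ τ' : Type} {ι : τ' → τ} {G : (σ → ℂ) → τ' → ℂ}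
    {H : (σ → ℂ) → τ → ℂ} (hG : ∀ e, IsPolyFun fun x => G x e)
    (hH : ∀ e, IsPolyFun fun x => H x e) (e : τ) :
    IsPolyFun fun x => Function.extend ι (G x) (H x) e := by
  classical
  unfold Function.extend
  split_ifs with h
  · exact hG _
  · exact hH _

theorem Function.Injective.extend_comp_self {τ τ' : Type} {ι : τ' → τ} (hι : ι.Injective)
    (c : τ → ℂ) : Function.extend ι (c ∘ ι) c = c := by
  funext e
  by_cases h : ∃ e', ι e' = e
  · obtain ⟨e', rfl⟩ := h
    rw [hι.extend_apply, Function.comp_apply]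
  · rw [Function.extend_apply' _ _ _ h]

/-! ### Comparison of a problem with its reduction -/

namespace PointLineProblem

variable {m : ℕ} {P P' : PointLineProblem m}

theorem IsJointImage.unique {S : World P.p P.l m} {y y' : P.Image} (h : P.IsJointImage S y)
    (h' : P.IsJointImage S y') : y = y' := by
  cases y
  cases y'
  congr
  · funext v i
    exact Projectivization.submodule_injective ((h.1 v i).trans (h'.1 v i).symm)
  · funext v j
    exact Subtype.ext ((h.2 v j).trans (h'.2 v j).symm)

namespace Forgetting

variable (F : Forgetting P P')

/-- The kept observed points. -/
def obsPtMap (w : Σ v, P'.obsPt v) : Σ v, P.obsPt v :=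
  ⟨w.1, F.keptPt w.2, (F.obsPt_iff w.1 w.2).1 w.2.2⟩

/-- The kept observed lines. -/
def obsLineMap (u : Σ v, P'.obsLine v) : Σ v, P.obsLine v :=
  ⟨u.1, F.keptLine u.2, (F.obsLine_iff u.1 u.2).1 u.2.2⟩

theorem obsPtMap_injective : F.obsPtMap.Injective := by
  rintro ⟨v, i, hi⟩ ⟨v', i', hi'⟩ h
  obtain rfl : v = v' := congrArg Sigma.fst h
  have h1 := congrArg Subtype.val (eq_of_heq (Sigma.mk.inj h).2)
  obtain rfl : i = i' := F.keptPt.injective h1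
  rfl

theorem obsLineMap_injective : F.obsLineMap.Injective := by
  rintro ⟨v, i, hi⟩ ⟨v', i', hi'⟩ h
  obtain rfl : v = v' := congrArg Sigma.fst h
  have h1 := congrArg Subtype.val (eq_of_heq (Sigma.mk.inj h).2)
  obtain rfl : i = i' := F.keptLine.injective h1
  rfl

/-- The coordinates of a joint image that describe its projection. -/
noncomputable def imageIndexMap : P'.ImageIndex → P.ImageIndex :=
  restrictIndex P.imageInc P'.imageInc F.obsPtMap F.obsLineMap

variable {F}

/-- This is the only place where feasibility is needed: the vector of a forgotten point is inherited
by at most one kept line. As a result, projecting joint images amounts to dropping some coordinates.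
-/
theorem imageIndexMap_injective (hP : P.IsPL1P) (hP' : P'.IsPL1P) (hF : F.IsFeasible) :
    F.imageIndexMap.Injective := by
  have hforget : ∀ w u, P'.imageInc u = none →
      P.imageInc (F.obsLineMap u) ≠ some (F.obsPtMap w) := by
    intro w u hu hwu
    obtain ⟨h1, h2⟩ := (imageInc_eq_some_iff hP).1 hwu
    have h3 := (imageInc_eq_some_iff (w := w) (u := u) hP').2 ⟨h1, (F.inc_iff _ _).2 h2⟩
    rw [hu] at h3
    exact Option.some_ne_none _ h3.symm
  refine restrictIndex_injective F.obsPtMap_injective F.obsLineMap_injective hforget ?_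
  intro w u u' hu hu' hw hw'
  obtain ⟨h1, h2⟩ := (imageInc_eq_some_iff hP).1 hw
  obtain ⟨h1', h2'⟩ := (imageInc_eq_some_iff hP).1 hw'
  obtain ⟨v, j, hj⟩ := u
  obtain ⟨v', j', hj'⟩ := u'
  obtain rfl : v = v' := h1.symm.trans h1'
  have hrange : w.2.1 ∉ Set.range F.keptPt := by
    rintro ⟨i, hi⟩
    obtain ⟨v, i', hi'⟩ := w
    obtain rfl : F.keptPt i = i' := hi
    exact hforget ⟨v, i, (F.obsPt_iff v i).2 hi'⟩ _ hu hw
  obtain rfl : j = j' := hF _ hrange j j' h2 h2'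
  rfl

theorem _root_.PointLineProblem.ImageRep.onImage (hP : P.IsPL1P) (hP' : P'.IsPL1P)
    {c : P.ImageIndex → ℂ} {y : P.Image} (h : ImageRep c y) :
    ImageRep (c ∘ F.imageIndexMap) (F.onImage y) :=
  Represents.restrict h fun w u hwu => by
    obtain ⟨h1, h2⟩ := (imageInc_eq_some_iff hP').1 hwu
    exact (imageInc_eq_some_iff hP).2 ⟨h1, (F.inc_iff _ _).1 h2⟩

/-- The fibres of the projection of joint images are irreducible. -/
theorem isPreirreducible_fibre (hP : P.IsPL1P) (hP' : P'.IsPL1P) (hF : F.IsFeasible)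
    {c' : P'.ImageIndex → ℂ} {y' : P'.Image} (hc' : ImageRep c' y') :
    IsPreirreducible {y | y ∈ P.imageVariety ∧ F.onImage y = y'} := by
  have hι := imageIndexMap_injective hP hP' hF
  let z : (Σ v, P'.obsLine v) → Fin 2 → Fin 3 → ℂ := fun u r =>
    if r = 0 then fstVec P'.imageInc c' u else lineVec c' u 1
  -- The kept coordinates run through the coordinate vectors of `y'` and the others are free. This
  -- polynomial map from an affine space reaches all coordinate vectors of the fibre, which makes
  -- the fibre irreducible.
  let Θ : (RecoordIndex (Σ v, P'.obsPt v) (Σ v, P'.obsLine v) 3 ⊕ P.ImageIndex → ℂ) →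
      P.ImageIndex → ℂ := fun x => Function.extend F.imageIndexMap
    (recoord P'.imageInc (ptVec c') z fun e => x (.inl e)) fun e => x (.inr e)
  have hΘ : ∀ e, IsPolyFun fun x => Θ x e := isPolyFun_extend
    (isPolyFun_recoord (fun _ _ => .const _) (fun _ _ _ => .const _) fun _ => .coord _)
    fun _ => .coord _
  have key : ∀ U : Set P.Image, IsOpen U →
      ({y | y ∈ P.imageVariety ∧ F.onImage y = y'} ∩ U).Nonempty →
      ∃ O : Set (P.ImageIndex → ℂ), ZOpen O ∧ (Θ ⁻¹' O).Nonempty ∧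
        ∀ c ∈ O, ∃ y ∈ U, ImageRep c y := by
    rintro U hU ⟨y, ⟨hy, hyy'⟩, hyU⟩
    obtain ⟨c, hc⟩ := (exists_imageRep_iff hP).2 hy
    obtain ⟨O, hO, hcO, hOU⟩ := hc.exists_open hU hyU
    have h1 : ImageRep (c ∘ F.imageIndexMap) y' := hyy' ▸ hc.onImage hP hP'
    obtain ⟨g, hg⟩ := Represents.exists_recoord_eq (z := z) h1 hc'.1 hc'.2
    refine ⟨O, hO, ⟨Sum.elim g c, ?_⟩, hOU⟩
    have h2 : Θ (Sum.elim g c) = c := by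
      simp only [Θ, Sum.elim_inl, Sum.elim_inr]
      rw [hg]
      exact hι.extend_comp_self c
    rw [Set.mem_preimage, h2]
    exact hcO
  intro U1 U2 hU1 hU2 hne1 hne2
  obtain ⟨O1, hO1, hOne1, h1⟩ := key U1 hU1 hne1
  obtain ⟨O2, hO2, hOne2, h2⟩ := key U2 hU2 hne2
  obtain ⟨x, hx1, hx2⟩ := (hO1.preimage hΘ).inter_nonempty (hO2.preimage hΘ) hOne1 hOne2
  obtain ⟨y, hyU1, hy⟩ := h1 _ hx1
  obtain ⟨y2, hyU2, hy2⟩ := h2 _ hx2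
  obtain rfl := hy.unique hy2
  refine ⟨y, ⟨(exists_imageRep_iff hP).1 ⟨_, hy⟩, ?_⟩, hyU1, hyU2⟩
  have h3 := hy.onImage (F := F) hP hP'
  have h4 : Θ x ∘ F.imageIndexMap = recoord P'.imageInc (ptVec c') z fun e => x (.inl e) :=
    _root_.funext fun e => hι.extend_apply
      (recoord P'.imageInc (ptVec c') z fun e => x (.inl e)) (fun e => x (.inr e)) e
  rw [h4] at h3
  have h5 := Represents.of_recoord h3 fun w u hwu => by
    refine Submodule.subset_span (.inl ?_)
    simp [z, fstVec, hwu]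
  exact ImageRep.unique (c := c') h5 hc'

/-- A nonempty open subset of the image variety meets the generic fibre of the projection. -/
theorem exists_fibre_inter_nonempty (hP : P.IsPL1P) (hP' : P'.IsPL1P) (hF : F.IsFeasible)
    {U : Set P.Image} (hU : IsOpen U) (hne : (P.imageVariety ∩ U).Nonempty) :
    ∃ O : Set (P'.ImageIndex → ℂ), ZOpen O ∧ O.Nonempty ∧ ∀ c ∈ O, ∀ y', ImageRep c y' →
      ({y | y ∈ P.imageVariety ∧ F.onImage y = y'} ∩ U).Nonempty := by
  have hι := imageIndexMap_injective hP hP' hF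
  obtain ⟨y, hy, hyU⟩ := hne
  obtain ⟨c, hc⟩ := (exists_imageRep_iff hP).2 hy
  obtain ⟨O, hO, hcO, hOU⟩ := hc.exists_open hU hyU
  -- The dropped coordinates stay fixed at those of `c`, and the kept ones vary.
  refine ⟨(fun c' => Function.extend F.imageIndexMap c' c) ⁻¹' O,
    hO.preimage (isPolyFun_extend (fun _ => .coord _) fun _ => .const _),
    ⟨c ∘ F.imageIndexMap, ?_⟩, fun c' hc' y' hy' => ?_⟩
  · rw [Set.mem_preimage, hι.extend_comp_self]
    exact hcO
  · obtain ⟨y1, hy1U, hy1⟩ := hOU _ hc'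
    refine ⟨y1, ⟨(exists_imageRep_iff hP).1 ⟨_, hy1⟩, ?_⟩, hy1U⟩
    have h := hy1.onImage (F := F) hP hP'
    have h' : Function.extend F.imageIndexMap c' c ∘ F.imageIndexMap = c' :=
      _root_.funext fun e => hι.extend_apply c' c e
    simp only [h'] at h
    exact h.unique hy'

theorem onWorld_mem_solutions {y : P.Image} {S : World P.p P.l m} (hS : S ∈ P.solutions y) :
    F.onWorld S ∈ P'.solutions (F.onImage y) :=
  ⟨⟨fun _ _ hij => hS.1.1 _ _ ((F.inc_iff _ _).1 hij), hS.1.2⟩, fun v _ => hS.2.1 v _,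
    fun v _ => hS.2.2 v _⟩

/-- Finitely many solutions are told apart by their cameras, and forgetting keeps the cameras; so it
is injective on solutions. -/
theorem encard_solutions_le (hP : P.IsPL1P) {y : P.Image} (hfin : (P.solutions y).Finite) :
    (P.solutions y).encard ≤ (P'.solutions (F.onImage y)).encard := by
  have hinj : Set.InjOn F.onWorld (P.solutions y) := fun S hS S' hS' h =>
    eq_of_cam_eq hP hfin hS hS' (congrArg (fun S'' : World P'.p P'.l m => S''.cam) h)
  rw [← hinj.encard_image]
  refine Set.encard_le_encard ?_
  rintro _ ⟨S, hS, rfl⟩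
  exact onWorld_mem_solutions hS

/-- Finitely many solutions that lift generically lift to one joint image. -/
theorem encard_inter_le (hP : P.IsPL1P) (hP' : P'.IsPL1P) (hF : F.IsFeasible)
    {c' : P'.ImageIndex → ℂ} {y' : P'.Image} (hc' : ImageRep c' y') {U : Set P.Image}
    (hU : IsOpen U) (hne : ({y | y ∈ P.imageVariety ∧ F.onImage y = y'} ∩ U).Nonempty) {d : ℕ}
    (hd : ∀ y ∈ P.imageVariety ∩ U, (P.solutions y).encard = d) {T : Set (World P'.p P'.l m)}
    (hT : ∀ S' ∈ T, Generically {y | y ∈ P.imageVariety ∧ F.onImage y = y'} fun y =>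
      ∃ S ∈ P.solutions y, F.onWorld S = S') :
    T.encard ≤ d := by
  classical
  by_contra! hlt
  obtain ⟨T', hT', hTd⟩ := Set.exists_subset_encard_eq (Order.add_one_le_of_lt hlt)
  have hTfin : T'.Finite := Set.finite_of_encard_eq_coe (k := d + 1) (by simpa using hTd)
  have : Nonempty (Set P.Image) := ⟨∅⟩
  choose! W hW hdense hlift using fun S' hS' => hT S' (hT' hS')
  have hirr : IsIrreducible {y | y ∈ P.imageVariety ∧ F.onImage y = y'} :=
    ⟨hne.mono Set.inter_subset_left, isPreirreducible_fibre hP hP' hF hc'⟩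
  -- In an irreducible fibre finitely many nonempty open sets have a common point: there `y` has
  -- exactly `d` solutions, and all `d + 1` members of `T'` lift to it.
  obtain ⟨y, hy, hyW⟩ := isIrreducible_iff_sInter.1 hirr (insert U (hTfin.toFinset.image W))
    (by
      intro u hu
      rcases Finset.mem_insert.1 hu with rfl | hu
      · exact hU
      · obtain ⟨S', hS', rfl⟩ := Finset.mem_image.1 hu
        exact hW S' (hTfin.mem_toFinset.1 hS'))
    (by
      intro u hu
      rcases Finset.mem_insert.1 hu with rfl | hu
      · exact hne
      · obtain ⟨S', hS', rfl⟩ := Finset.mem_image.1 hu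
        exact closure_nonempty_iff.1 (hirr.1.mono (hdense S' (hTfin.mem_toFinset.1 hS'))))
  rw [Set.mem_sInter] at hyW
  have hyU : y ∈ U := hyW U (by simp)
  have hsub : T' ⊆ F.onWorld '' P.solutions y := by
    intro S' hS'
    have h1 : y ∈ W S' := hyW _ (by
      rw [Finset.coe_insert, Finset.coe_image]
      exact .inr ⟨S', by simpa using hS', rfl⟩)
    exact hlift S' hS' y ⟨hy, h1⟩
  have h2 := (Set.encard_le_encard hsub).trans (Set.encard_image_le _ _)
  rw [hTd, hd y ⟨hy.1, hyU⟩] at h2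
  norm_cast at h2
  omega

/-- A reduction of a minimal problem is minimal, of the same degree. -/
theorem hasDegree (hP : P.IsPL1P) (hP' : P'.IsPL1P) (hdom : P.IsDominant) (hF : F.IsFeasible)
    (hlift : F.HasLifting) {d : ℕ} (hd : P.HasDegree d) : P'.HasDegree d := by
  -- Dominance provides a point of the image variety and, by projecting `S0`, one of the domain of
  -- `P'`; by density the open sets `U` and `U'` then meet these varieties.
  obtain ⟨y0, hy0, S0, hS0⟩ : ∃ y ∈ P.imageVariety, (P.solutions y).Nonempty := by
    obtain ⟨O, hO, hOne, h⟩ := (generically_imageVariety_iff hP).1 hdom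
    obtain ⟨c, hcO, hc⟩ := hO.inter_nonempty zOpen_nondegenerate hOne
      (nondegenerate_nonempty (n := 3) (by norm_num) P.imageInc)
    obtain ⟨y, hy⟩ := exists_imageRep_of_mem_nondegenerate hc
    exact ⟨y, (exists_imageRep_iff hP).1 ⟨c, hy⟩, h c hcO y hy⟩
  obtain ⟨U, hU, hdense, hUd⟩ := hd
  obtain ⟨U', hU', hdense', hlift⟩ := hlift
  obtain ⟨O, hO, hOne, hfib⟩ := exists_fibre_inter_nonempty (F := F) hP hP' hF hU
    (closure_nonempty_iff.1 ⟨y0, hdense hy0⟩)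
  have hle : ∀ c ∈ O, ∀ y', ImageRep c y' → (P'.solutions y' ∩ U').encard ≤ d := by
    intro c hc y' hy'
    refine encard_inter_le hP hP' hF hy' hU (hfib c hc y' hy') hUd ?_
    rintro S' ⟨hS', hS'U⟩
    obtain ⟨y'', hy'', h⟩ := hlift S' ⟨hS'.1, hS'U⟩
    obtain rfl := hS'.2.unique hy''
    exact h
  -- The bound holds so far only for solutions in `U'`; its finiteness rules out further solutions
  -- over a generic joint image.
  obtain ⟨O', hO', hOne', hsub⟩ := solutions_subset_of_finite hP' hU'
    (closure_nonempty_iff.1 ⟨_, hdense' (onWorld_mem_solutions (F := F) hS0).1⟩)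
    ⟨O, hO, hOne, fun c hc y' hy' => Set.finite_of_encard_le_coe (hle c hc y' hy')⟩
  refine (generically_imageVariety_iff hP').2 ⟨O ∩ O', hO.inter hO',
    hO.inter_nonempty hO' hOne hOne', fun c hc y' hy' => le_antisymm ?_ ?_⟩
  · rw [← Set.inter_eq_left.2 (hsub c hc.2 y' hy')]
    exact hle c hc.1 y' hy'
  · obtain ⟨y, ⟨hy, rfl⟩, hyU⟩ := hfib c hc.1 y' hy'
    rw [← hUd y ⟨hy, hyU⟩]
    exact encard_solutions_le hP (Set.finite_of_encard_eq_coe (hUd y ⟨hy, hyU⟩))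

end Forgetting

theorem HasDegree.isMinimal {d : ℕ} (hd : P.HasDegree d) (hd0 : d ≠ 0) : P.IsMinimal := by
  obtain ⟨U, hU, hdense, h⟩ := hd
  refine ⟨⟨U, hU, hdense, fun y hy => ?_⟩, U, hU, hdense, fun y hy => ?_⟩
  · refine Set.encard_ne_zero.1 ?_
    rw [h y hy]
    exact_mod_cast hd0
  · exact Set.finite_of_encard_eq_coe (h y hy)

theorem HasDegree.ne_zero (hP : P.IsPL1P) {d : ℕ} (hd : P.HasDegree d) (hdom : P.IsDominant) :
    d ≠ 0 := by
  rintro rfl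
  obtain ⟨O, hO, hOne, h⟩ := (generically_imageVariety_iff hP).1 hdom
  obtain ⟨O', hO', hOne', h'⟩ := (generically_imageVariety_iff hP).1 hd
  obtain ⟨c, ⟨hcO, hcO'⟩, hc⟩ := (hO.inter hO').inter_nonempty zOpen_nondegenerate
    (hO.inter_nonempty hO' hOne hOne')
    (nondegenerate_nonempty (n := 3) (by norm_num) P.imageInc)
  obtain ⟨y, hy⟩ := exists_imageRep_of_mem_nondegenerate hc
  have h0 := h' c hcO' y hy
  rw [Nat.cast_zero, Set.encard_eq_zero] at h0
  exact (h c hcO y hy).ne_empty h0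

end PointLineProblem

end

theorem theorem1 {m : ℕ} (P P' : PointLineProblem m) (hP : P.IsPL1P) (hP' : P'.IsPL1P)
    (hmin : P.IsMinimal) (hred : P.IsReducibleTo P') :
    P.IsMinimal ∧ P'.IsMinimal ∧ ∃ d : ℕ, P.HasDegree d ∧ P'.HasDegree d := by
  obtain ⟨F, hF, hlift⟩ := hred
  obtain ⟨d, hd⟩ := PointLineProblem.exists_hasDegree hP hmin.2
  have hd' := F.hasDegree hP hP' hmin.1 hF hlift hd
  exact ⟨hmin, hd'.isMinimal (hd.ne_zero hP hmin.1), d, hd, hd'⟩
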